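/- Let $P_0(x)=a_0+\cdots+a_{\ell_0}x^{\ell_0}$ and $P_1(x)=b_0+\cdots+b_{\ell_1}x^{\ell_1}$ be real polynomials, where $\ell_0,\ell_1\ge 0$ and $a_{\ell_0}b_{\ell_1}\neq 0$. The polynomial Liénard system $$\dot x=y,\qquad \dot y=P_0(x)+P_1(x)\,y$$ is called monodromic at infinity if, in its Poincaré compactification, no orbit of the system (that is, no orbit in the finite part of the phase plane) tends, in forward or in backward time, to an equilibrium on the equator of the Poincaré sphere. This system is monodromic at infinity if and only if one of the following two conditions holds: (L1) $\ell_0$ is odd, $\ell_0>2\ell_1+1$ and $a_{\ell_0}<0$; (L2) $\ell_0=2\ell_1+1$ and $b_{\ell_1}^2+2(\ell_0+1)a_{\ell_0}<0$. -/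

import Mathlib

open Filter Topology

noncomputable section

/-- A real polynomial vector field `P ∂/∂x + Q ∂/∂y` on the plane, that is, the autonomous system
`x' = P(x, y)`, `y' = Q(x, y)`; the variables `0` and `1` are `x` and `y`. -/
structure PlanarSystem where
  P : MvPolynomial (Fin 2) ℝ
  Q : MvPolynomial (Fin 2) ℝ

/-- The homogenization of degree `d` of a bivariate polynomial `F` of degree at most `d`, as a
function on `ℝ³`. It is the continuous extension to the plane `z 2 = 0` of
`z ↦ (z 2) ^ d * F (z 0 / z 2, z 1 / z 2)`. -/
def homogenization (d : ℕ) (F : MvPolynomial (Fin 2) ℝ) (z : Fin 3 → ℝ) : ℝ :=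
  ∑ j ∈ Finset.range (d + 1),
    z 2 ^ (d - j) * MvPolynomial.eval ![z 0, z 1] (MvPolynomial.homogeneousComponent j F)

namespace PlanarSystem

/-- The degree `max (deg P) (deg Q)` of a polynomial system. -/
def degree (S : PlanarSystem) : ℕ :=
  max S.P.totalDegree S.Q.totalDegree

/-- The Poincaré compactification of a polynomial system of degree `d`. The plane is identified
with the open northern hemisphere of the unit sphere of `ℝ³` by the central projection
`(x, y) ↦ (x, y, 1) / √(x² + y² + 1)`. The image of the system under this map, multiplied by
`(z 2) ^ (d - 1)`, extends to the tangent vector field of the sphere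
`z ↦ (p, q, 0) - (z 0 * p + z 1 * q) • z`, where `p` and `q` are the homogenizations of degree `d`
of the two components. The equator `z 2 = 0` is invariant. -/
def poincareField (S : PlanarSystem) (z : Fin 3 → ℝ) : Fin 3 → ℝ :=
  let p := homogenization S.degree S.P z
  let q := homogenization S.degree S.Q z
  let r := z 0 * p + z 1 * q
  ![p - r * z 0, q - r * z 1, -(r * z 2)]

end PlanarSystem

/-- The open northern hemisphere of the unit sphere of `ℝ³`: the finite part of the phase plane. -/
def northernHemisphere : Set (Fin 3 → ℝ) :=
  {z | z 0 ^ 2 + z 1 ^ 2 + z 2 ^ 2 = 1 ∧ 0 < z 2}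

/-- The equator of the unit sphere of `ℝ³`: the points at infinity of the phase plane. -/
def equator : Set (Fin 3 → ℝ) :=
  {z | z 0 ^ 2 + z 1 ^ 2 + z 2 ^ 2 = 1 ∧ z 2 = 0}

namespace PlanarSystem

/-- `e` is an equilibrium at infinity: a zero of the Poincaré compactification on the equator. -/
def IsEquilibriumAtInfinity (S : PlanarSystem) (e : Fin 3 → ℝ) : Prop :=
  e ∈ equator ∧ S.poincareField e = 0

/-- Some orbit of the system (in the finite part of the phase plane) tends to `e` in the Poincaré
compactification, either in forward or in backward time. Only the half of the orbit that tends to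
`e` is parametrized: since the sphere is compact, it is always part of a complete orbit. -/
def HasOrbitConnectingWith (S : PlanarSystem) (e : Fin 3 → ℝ) : Prop :=
  ∃ γ : ℝ → Fin 3 → ℝ,
    (IsIntegralCurveOn γ (fun _ => S.poincareField) (Set.Ici 0) ∧
      (∀ t ∈ Set.Ici (0 : ℝ), γ t ∈ northernHemisphere) ∧ Tendsto γ atTop (𝓝 e)) ∨
    (IsIntegralCurveOn γ (fun _ => S.poincareField) (Set.Iic 0) ∧
      (∀ t ∈ Set.Iic (0 : ℝ), γ t ∈ northernHemisphere) ∧ Tendsto γ atBot (𝓝 e))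

/-- Monodromy at infinity: no orbit of the system connects with an equilibrium on the equator of
the Poincaré sphere. -/
def MonodromicAtInfinity (S : PlanarSystem) : Prop :=
  ∀ e : Fin 3 → ℝ, S.IsEquilibriumAtInfinity e → ¬ S.HasOrbitConnectingWith e

end PlanarSystem

/-- The polynomial Liénard system `x' = y`, `y' = P₀(x) + P₁(x) y`. -/
def lienardSystem (P₀ P₁ : Polynomial ℝ) : PlanarSystem where
  P := MvPolynomial.X 1
  Q := Polynomial.aeval (MvPolynomial.X 0) P₀ +
    Polynomial.aeval (MvPolynomial.X 0) P₁ * MvPolynomial.X 1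

end

/-! Central projection turns the compactified flow into the Liénard system run at the positive speed
`z 2 ^ (d - 1)`. The reflections x → s x, t → τ t, y → s τ y keep the Liénard form and the
disjunction of (L1) and (L2), so it suffices to study forward orbits with x → +∞ and y > 0.

Let m = ℓ₁, let b be the leading coefficient of P₁ and a the coefficient of x^(2m+1) in P₀. An orbit
crosses the curve y = g(x) > 0 upwards where g g' < P₀ + P₁ g. If ℓ₀ ≤ 2m+1 and g = c x^(m+1), the
leading coefficient of P₀ + P₁ g - g g' is a + b c - (m+1) c², a quadratic in c of discriminant b² +
4(m+1) a, which is the quantity in (L2) when ℓ₀ = 2m+1.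

Under (L2) this discriminant is negative; under (L1) the term P₀ dominates with a negative sign.
Either way y / x^(m+1) + δ log x is nonincreasing for some δ > 0, which is impossible if x → +∞ with
y > 0 (`LienardOrbit.false_of_tendsto_atTop`).

If both conditions fail, a suitable reflection admits a barrier g with g(x)/x → ∞, or an invariant
line when both polynomials have low degree. Orbits above the barrier stay above it and escape in the
direction (0, 1); those on the line escape along it (`hasEscapingOrbit_of_not`,
`hasEscapingOrbit_of_const`). -/

/-! ### General facts on integral curves -/

/-- A bounded Lipschitz vector field on a Banach space is complete. -/
theorem exists_isIntegralCurve_of_lipschitzWith_of_bounded {E : Type*} [NormedAddCommGroup E]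
    [NormedSpace ℝ E] [CompleteSpace E] {f : E → E} {K L : NNReal} (hK : LipschitzWith K f)
    (hL : ∀ z, ‖f z‖ ≤ L) (z₀ : E) :
    ∃ γ : ℝ → E, γ 0 = z₀ ∧ ∀ t, HasDerivAt γ (f (γ t)) t := by
  have key : ∀ T : NNReal, ∃ α : ℝ → E, α 0 = z₀ ∧
      ∀ t ∈ Set.Ioo (-(T : ℝ)) T, HasDerivAt α (f (α t)) t := by
    intro T
    have h0 : (0 : ℝ) ∈ Set.Icc (-(T : ℝ)) T := ⟨by simp, T.2⟩
    -- A curve of speed at most `L` moves by at most `L * T` in time `T`, so a ball of that radius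
    -- imposes no restriction on the time.
    have hPL : IsPicardLindelof (fun _ ↦ f) (⟨0, h0⟩ : Set.Icc (-(T : ℝ)) T) z₀ (L * T) 0 L K :=
      IsPicardLindelof.of_time_independent (fun x _ ↦ hL x) hK.lipschitzOnWith (by simp)
    obtain ⟨α, hα, h⟩ := hPL.exists_eq_forall_mem_Icc_hasDerivWithinAt₀
    exact ⟨α, hα, fun t ht ↦ (h t (Set.Ioo_subset_Icc_self ht)).hasDerivAt (Icc_mem_nhds ht.1 ht.2)⟩
  choose α hα0 hα using key
  have huniq : ∀ S T : NNReal, S ≤ T → 0 < S → Set.EqOn (α S) (α T) (Set.Ioo (-(S : ℝ)) S) := by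
    intro S T hST hS
    have hST' : (S : ℝ) ≤ T := hST
    have hS' : (0 : ℝ) < S := hS
    refine ODE_solution_unique_of_mem_Ioo (v := fun _ ↦ f) (s := fun _ ↦ Set.univ) (K := K)
      (t₀ := 0) (fun _ _ ↦ hK.lipschitzOnWith) ⟨by linarith, hS'⟩
      (fun t ht ↦ ⟨hα S t ht, trivial⟩)
      (fun t ht ↦ ⟨hα T t ⟨by linarith [ht.1], by linarith [ht.2]⟩, trivial⟩) (by rw [hα0, hα0])
  -- The horizon |t| + 1 keeps t interior; near t all the horizons |s| + 1 are below |t| + 2, so a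
  -- single local solution serves there.
  refine ⟨fun t ↦ α (‖t‖₊ + 1) t, by simp [hα0], fun t ↦ ?_⟩
  have hev : (fun s ↦ α (‖s‖₊ + 1) s) =ᶠ[𝓝 t] α (‖t‖₊ + 2) := by
    have h1 : ∀ᶠ s in 𝓝 t, ‖s‖₊ < ‖t‖₊ + 1 :=
      (continuous_nnnorm.continuousAt).eventually_lt continuousAt_const (by simp)
    filter_upwards [h1] with s hs
    refine huniq _ _ ?_ (by positivity) ?_
    · calc ‖s‖₊ + 1 ≤ (‖t‖₊ + 1) + 1 := by gcongr
        _ = ‖t‖₊ + 2 := by ring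
    · have : |s| < |s| + 1 := by linarith
      simpa [Set.mem_Ioo] using abs_lt.1 this
  have hmem : t ∈ Set.Ioo (-((‖t‖₊ + 2 : NNReal) : ℝ)) ((‖t‖₊ + 2 : NNReal) : ℝ) := by
    have : |t| < |t| + 2 := by linarith
    simpa [Set.mem_Ioo] using abs_lt.1 this
  have h := (hα (‖t‖₊ + 2) t hmem).congr_of_eventuallyEq hev
  have e : α (‖t‖₊ + 1) t = α (‖t‖₊ + 2) t := hev.eq_of_nhds
  rwa [← e] at h

/-- Solutions of a scalar linear differential equation. -/
theorem eq_mul_exp_of_hasDerivAt_mul {s : Set ℝ} (hs : Convex ℝ s) (h0 : (0 : ℝ) ∈ s)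
    {c u : ℝ → ℝ} (hc : Continuous c) (hu : ∀ t ∈ s, HasDerivAt u (c t * u t) t) :
    ∀ t ∈ s, u t = u 0 * Real.exp (∫ r in (0 : ℝ)..t, c r) := by
  intro t ht
  have hI : ∀ t, HasDerivAt (fun t ↦ ∫ r in (0 : ℝ)..t, c r) (c t) t := fun t ↦
    intervalIntegral.integral_hasDerivAt_right (hc.intervalIntegrable _ _)
      (hc.stronglyMeasurableAtFilter _ _) hc.continuousAt
  set v : ℝ → ℝ := fun t ↦ u t * Real.exp (-∫ r in (0 : ℝ)..t, c r) with hv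
  have hv' : ∀ t ∈ s, HasDerivWithinAt v 0 s t := by
    intro t ht
    have := ((hu t ht).mul (hI t).neg.exp).hasDerivWithinAt (s := s)
    convert! this using 1
    ring
  have h := hs.norm_image_sub_le_of_norm_hasDerivWithin_le (C := 0) hv' (by simp) h0 ht
  have h' : v t = u 0 := by
    have : v t - v 0 = 0 := by simpa using h
    have h2 : v 0 = u 0 := by simp [hv]
    linarith
  rw [← h', hv]
  simp only
  rw [mul_assoc, ← Real.exp_add]
  simp

/-- An integral curve of a continuous field can only converge to a zero of the field. -/
theorem eq_zero_of_tendsto_of_hasDerivAt {ι : Type*} [Fintype ι] {v : (ι → ℝ) → ι → ℝ}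
    (hv : Continuous v) {γ : ℝ → ι → ℝ} {e : ι → ℝ} (hγ : ∀ t, HasDerivAt γ (v (γ t)) t)
    (he : Tendsto γ atTop (𝓝 e)) : v e = 0 := by
  funext i
  have hd : ∀ t, HasDerivAt (fun t ↦ γ t i) (v (γ t) i) t := fun t ↦ hasDerivAt_pi.1 (hγ t) i
  have hci : Tendsto (fun t ↦ γ t i) atTop (𝓝 (e i)) := (tendsto_pi_nhds.1 he) i
  -- By the mean value theorem on [t, t + 1], the field at some later time equals an increment of
  -- the curve, and these increments tend to 0.
  have hmv : ∀ t : ℝ, ∃ ξ, t < ξ ∧ v (γ ξ) i = γ (t + 1) i - γ t i := by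
    intro t
    obtain ⟨ξ, hξ, h⟩ := exists_hasDerivAt_eq_slope (fun t ↦ γ t i) (fun t ↦ v (γ t) i)
      (show t < t + 1 by linarith) (fun s _ ↦ (hd s).continuousAt.continuousWithinAt)
      (fun s _ ↦ hd s)
    exact ⟨ξ, hξ.1, by simpa using h⟩
  choose ξ hξ h using hmv
  have hξ' : Tendsto ξ atTop atTop := tendsto_atTop_mono (fun t ↦ (hξ t).le) tendsto_id
  have hvc : Tendsto (fun t ↦ v (γ (ξ t)) i) atTop (𝓝 (v e i)) :=
    (((continuous_apply i).comp hv).tendsto e).comp (he.comp hξ')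
  have h0 : Tendsto (fun t ↦ γ (t + 1) i - γ t i) atTop (𝓝 (e i - e i)) :=
    (hci.comp (tendsto_atTop_add_const_right _ 1 tendsto_id)).sub hci
  simp only [h] at hvc
  have := tendsto_nhds_unique hvc h0
  simpa using this

/-! ### The Poincaré field and its complete orbits -/

theorem homogenization_eq {d : ℕ} {F : MvPolynomial (Fin 2) ℝ} (hF : F.totalDegree ≤ d)
    {z : Fin 3 → ℝ} (hz : z 2 ≠ 0) :
    homogenization d F z = z 2 ^ d * MvPolynomial.eval ![z 0 / z 2, z 1 / z 2] F := by
  have hsum : F = ∑ j ∈ Finset.range (d + 1), MvPolynomial.homogeneousComponent j F := by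
    conv_lhs => rw [← MvPolynomial.sum_homogeneousComponent F]
    refine Finset.sum_subset (Finset.range_mono (by omega)) fun j _ hj ↦ ?_
    exact MvPolynomial.homogeneousComponent_eq_zero _ _ (by rw [Finset.mem_range] at hj; omega)
  conv_rhs => rw [hsum]
  rw [map_sum, Finset.mul_sum, homogenization]
  refine Finset.sum_congr rfl fun j hj ↦ ?_
  have hj' : j ≤ d := by simpa [Nat.lt_succ_iff] using hj
  have hvec : (![z 0, z 1] : Fin 2 → ℝ) = fun i ↦ z 2 * ![z 0 / z 2, z 1 / z 2] i := by
    funext i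
    fin_cases i <;> simp <;> field_simp
  have hom := MvPolynomial.homogeneousComponent_isHomogeneous j F
  have : MvPolynomial.eval ![z 0, z 1] (MvPolynomial.homogeneousComponent j F) =
      z 2 ^ j * MvPolynomial.eval ![z 0 / z 2, z 1 / z 2]
        (MvPolynomial.homogeneousComponent j F) := by
    rw [hvec, MvPolynomial.eval_eq, MvPolynomial.eval_eq, Finset.mul_sum]
    refine Finset.sum_congr rfl fun m hm ↦ ?_
    have hdeg : m.degree = j := by
      have := hom (MvPolynomial.mem_support_iff.1 hm)
      rwa [Finsupp.degree_eq_weight_one]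
    rw [Finset.prod_congr rfl (fun i _ ↦ mul_pow _ _ _), Finset.prod_mul_distrib,
      Finset.prod_pow_eq_pow_sum]
    rw [Finsupp.degree_apply] at hdeg
    rw [hdeg]
    ring
  rw [this, ← mul_assoc, ← pow_add, Nat.sub_add_cancel hj']

theorem contDiff_homogenization (d : ℕ) (F : MvPolynomial (Fin 2) ℝ) :
    ContDiff ℝ 1 (homogenization d F) := by
  unfold homogenization
  refine ContDiff.sum fun j _ ↦ ContDiff.mul (by fun_prop) ?_
  simp only [MvPolynomial.eval_eq']
  refine ContDiff.sum fun m _ ↦ contDiff_const.mul ?_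
  simp only [Fin.prod_univ_two, Matrix.cons_val_zero, Matrix.cons_val_one]
  fun_prop

theorem PlanarSystem.contDiff_poincareField (S : PlanarSystem) :
    ContDiff ℝ 1 S.poincareField := by
  have hp := contDiff_homogenization S.degree S.P
  have hq := contDiff_homogenization S.degree S.Q
  refine contDiff_pi.2 fun i ↦ ?_
  fin_cases i
  · change ContDiff ℝ 1 fun z : Fin 3 → ℝ ↦ homogenization S.degree S.P z -
      (z 0 * homogenization S.degree S.P z + z 1 * homogenization S.degree S.Q z) * z 0
    fun_prop
  · change ContDiff ℝ 1 fun z : Fin 3 → ℝ ↦ homogenization S.degree S.Q z -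
      (z 0 * homogenization S.degree S.P z + z 1 * homogenization S.degree S.Q z) * z 1
    fun_prop
  · change ContDiff ℝ 1 fun z : Fin 3 → ℝ ↦
      -((z 0 * homogenization S.degree S.P z + z 1 * homogenization S.degree S.Q z) * z 2)
    fun_prop

/-- Through every finite point of the Poincaré sphere there is a complete orbit. -/
theorem PlanarSystem.exists_integralCurve (S : PlanarSystem) {z₀ : Fin 3 → ℝ}
    (hz₀ : z₀ ∈ northernHemisphere) :
    ∃ γ : ℝ → Fin 3 → ℝ, γ 0 = z₀ ∧ (∀ t, HasDerivAt γ (S.poincareField (γ t)) t) ∧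
      ∀ t, γ t ∈ northernHemisphere := by
  have hv := S.contDiff_poincareField
  -- The cutoff equals 1 on the unit ball of the sup norm, which contains the sphere, so it does not
  -- alter the flow there.
  let χ : ContDiffBump (0 : Fin 3 → ℝ) := ⟨1, 2, one_pos, by norm_num⟩
  set w : (Fin 3 → ℝ) → Fin 3 → ℝ := fun z ↦ χ z • S.poincareField z with hw
  have hχ : ContDiff ℝ 1 χ := χ.contDiff
  have hwc : ContDiff ℝ 1 w := hχ.smul hv
  have hws : HasCompactSupport w := χ.hasCompactSupport.smul_right
  obtain ⟨K, hK⟩ := ContDiff.lipschitzWith_of_hasCompactSupport hws hwc one_ne_zero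
  obtain ⟨L, hL⟩ := hws.exists_bound_of_continuous hwc.continuous
  obtain ⟨γ, h0, hγ⟩ := exists_isIntegralCurve_of_lipschitzWith_of_bounded (L := L.toNNReal) hK
    (fun z ↦ (hL z).trans (Real.le_coe_toNNReal L)) z₀
  have hγc : Continuous γ := continuous_iff_continuousAt.2 fun t ↦ (hγ t).continuousAt
  set r : (Fin 3 → ℝ) → ℝ := fun z ↦
    z 0 * homogenization S.degree S.P z + z 1 * homogenization S.degree S.Q z with hr
  have hrc : Continuous r := by
    have hp := (contDiff_homogenization S.degree S.P).continuous
    have hq := (contDiff_homogenization S.degree S.Q).continuous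
    fun_prop
  have hd : ∀ i t, HasDerivAt (fun t ↦ γ t i) (χ (γ t) * S.poincareField (γ t) i) t :=
    fun i t ↦ hasDerivAt_pi.1 (hγ t) i
  have hcoef : Continuous fun t ↦ χ (γ t) * r (γ t) :=
    (hχ.continuous.comp hγc).mul (hrc.comp hγc)
  -- Both |z|² - 1 and `z 2` solve scalar linear equations along the flow: the zero of the first and
  -- the sign of the second persist.
  have hφ : ∀ t ∈ (Set.univ : Set ℝ), HasDerivAt
      (fun t ↦ γ t 0 ^ 2 + γ t 1 ^ 2 + γ t 2 ^ 2 - 1)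
      ((-2 * (χ (γ t) * r (γ t))) * (γ t 0 ^ 2 + γ t 1 ^ 2 + γ t 2 ^ 2 - 1)) t := by
    intro t _
    have := ((((hd 0 t).pow 2).add ((hd 1 t).pow 2)).add ((hd 2 t).pow 2)).sub_const 1
    convert! this using 1
    simp [PlanarSystem.poincareField, hr]
    ring
  have hsph : ∀ t, γ t 0 ^ 2 + γ t 1 ^ 2 + γ t 2 ^ 2 = 1 := by
    intro t
    have := eq_mul_exp_of_hasDerivAt_mul convex_univ trivial (continuous_const.mul hcoef) hφ t
      trivial
    simp only [h0, hz₀.1] at this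
    linarith
  have hpos : ∀ t, 0 < γ t 2 := by
    intro t
    have hz : ∀ t ∈ (Set.univ : Set ℝ), HasDerivAt (fun t ↦ γ t 2)
        ((-(χ (γ t) * r (γ t))) * γ t 2) t := by
      intro t _
      convert! hd 2 t using 1
      simp [PlanarSystem.poincareField, hr]
      ring
    rw [eq_mul_exp_of_hasDerivAt_mul convex_univ trivial hcoef.neg hz t trivial, h0]
    exact mul_pos hz₀.2 (Real.exp_pos _)
  refine ⟨γ, h0, fun t ↦ ?_, fun t ↦ ⟨hsph t, hpos t⟩⟩
  have h1 : χ (γ t) = 1 := by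
    refine χ.one_of_mem_closedBall ?_
    rw [mem_closedBall_zero_iff]
    refine (pi_norm_le_iff_of_nonneg zero_le_one).2 fun i ↦ ?_
    rw [Real.norm_eq_abs]
    refine (sq_le_one_iff_abs_le_one _).1 ?_
    have := hsph t
    have h0 := sq_nonneg (γ t 0)
    have h1 := sq_nonneg (γ t 1)
    have h2 := sq_nonneg (γ t 2)
    fin_cases i
    · change γ t 0 ^ 2 ≤ 1
      linarith
    · change γ t 1 ^ 2 ≤ 1
      linarith
    · change γ t 2 ^ 2 ≤ 1
      linarith
  simpa [hw, h1] using hγ t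

/-! ### Liénard half-orbits and one-variable comparison -/

/-- A half-orbit, for `t ≥ 0`, of the Liénard system `x' = y`, `y' = P(x) + Q(x) y` run with a
positive variable speed `k`. -/
structure LienardOrbit (P Q : Polynomial ℝ) (X Y k : ℝ → ℝ) : Prop where
  hasDerivAt_fst : ∀ t, 0 ≤ t → HasDerivAt X (k t * Y t) t
  hasDerivAt_snd : ∀ t, 0 ≤ t → HasDerivAt Y (k t * (P.eval (X t) + Q.eval (X t) * Y t)) t
  speed_pos : ∀ t, 0 ≤ t → 0 < k t

/-- A half-orbit whose speed is continuous, and bounded below as long as the orbit is bounded. -/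
structure CompleteLienardOrbit (P Q : Polynomial ℝ) (X Y k : ℝ → ℝ) : Prop
    extends LienardOrbit P Q X Y k where
  speed_continuous : Continuous k
  speed_bound : ∀ R : ℝ, ∃ δ > 0, ∀ t, 0 ≤ t → |X t| ≤ R → |Y t| ≤ R → δ ≤ k t

theorem le_of_hasDerivAt_nonpos {f f' : ℝ → ℝ} {T : ℝ} (hf : ∀ t, T ≤ t → HasDerivAt f (f' t) t)
    (hf' : ∀ t, T ≤ t → f' t ≤ 0) {s t : ℝ} (hs : T ≤ s) (hst : s ≤ t) : f t ≤ f s := by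
  have : AntitoneOn f (Set.Ici T) := by
    refine antitoneOn_of_hasDerivWithinAt_nonpos (f' := f') (convex_Ici T)
      (fun t ht ↦ (hf t ht).continuousAt.continuousWithinAt)
      (fun t ht ↦ (hf t (interior_subset ht)).hasDerivWithinAt)
      (fun t ht ↦ hf' t (interior_subset ht))
  exact this hs (hs.trans hst) hst

theorem le_of_hasDerivAt_nonneg {f f' : ℝ → ℝ} {T : ℝ} (hf : ∀ t, T ≤ t → HasDerivAt f (f' t) t)
    (hf' : ∀ t, T ≤ t → 0 ≤ f' t) {s t : ℝ} (hs : T ≤ s) (hst : s ≤ t) : f s ≤ f t := by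
  have := le_of_hasDerivAt_nonpos (f := fun t ↦ -f t) (fun t ht ↦ (hf t ht).neg)
    (fun t ht ↦ neg_nonpos.2 (hf' t ht)) hs hst
  linarith

theorem Polynomial.tendsto_eval_div_pow (p : Polynomial ℝ) {N : ℕ} (hN : p.natDegree ≤ N) :
    Tendsto (fun x ↦ p.eval x / x ^ N) atTop (𝓝 (p.coeff N)) := by
  rcases hN.lt_or_eq with h | h
  · have := p.div_tendsto_atTop_zero_of_degree_lt (Polynomial.X ^ N) (by
      rw [Polynomial.degree_X_pow]
      exact Polynomial.degree_le_natDegree.trans_lt (by exact_mod_cast h))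
    rw [Polynomial.coeff_eq_zero_of_natDegree_lt h]
    simpa using this
  · rcases eq_or_ne p 0 with rfl | hp
    · simp
    have := p.div_tendsto_atTop_leadingCoeff_div_of_degree_eq (Polynomial.X ^ N) (by
      rw [Polynomial.degree_X_pow, Polynomial.degree_eq_natDegree hp, h])
    rw [← h]
    rw [← h] at this
    simpa using this

theorem Polynomial.eventually_eval_pos {p : Polynomial ℝ} (hp : 0 < p.coeff p.natDegree) :
    ∀ᶠ x in atTop, 0 < p.eval x := by
  filter_upwards [(p.tendsto_eval_div_pow le_rfl).eventually_const_lt hp, eventually_gt_atTop 0]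
    with x hx h0
  have := mul_pos hx (pow_pos h0 p.natDegree)
  rwa [div_mul_cancel₀ _ (pow_pos h0 _).ne'] at this

/-- A continuous function on `[0, ∞)` that cannot vanish for the first time stays positive. -/
theorem pos_of_no_first_zero {φ : ℝ → ℝ} (hc : ∀ t, 0 ≤ t → ContinuousAt φ t) (h0 : 0 < φ 0)
    (h : ∀ t, 0 < t → φ t = 0 → (∀ s, 0 ≤ s → s < t → 0 < φ s) → False) :
    ∀ t, 0 ≤ t → 0 < φ t := by
  by_contra! hcon
  obtain ⟨t₁, ht₁, hφ₁⟩ := hcon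
  set A : Set ℝ := {t | t ∈ Set.Icc 0 t₁ ∧ φ t ≤ 0} with hA
  have hcl : IsClosed A := by
    have hco : ContinuousOn φ (Set.Icc 0 t₁) := fun t ht ↦ (hc t ht.1).continuousWithinAt
    exact hco.preimage_isClosed_of_isClosed isClosed_Icc isClosed_Iic
  have hne : A.Nonempty := ⟨t₁, ⟨ht₁, le_rfl⟩, hφ₁⟩
  have hbdd : BddBelow A := ⟨0, fun t ht ↦ ht.1.1⟩
  have hmem := hcl.csInf_mem hne hbdd
  set τ := sInf A
  have hbefore : ∀ s, 0 ≤ s → s < τ → 0 < φ s := by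
    intro s hs hsτ
    by_contra! hneg
    exact absurd (csInf_le hbdd ⟨⟨hs, hsτ.le.trans hmem.1.2⟩, hneg⟩) (not_le.2 hsτ)
  have hτ : 0 < τ := by
    rcases hmem.1.1.lt_or_eq with h' | h'
    · exact h'
    · have := hmem.2
      rw [← h'] at this
      linarith
  refine h τ hτ (le_antisymm hmem.2 ?_) hbefore
  have hlim : Tendsto φ (𝓝[<] τ) (𝓝 (φ τ)) := (hc τ hτ.le).tendsto.mono_left nhdsWithin_le_nhds
  refine ge_of_tendsto hlim ?_
  filter_upwards [Ioo_mem_nhdsLT hτ] with s hs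
  exact (hbefore s hs.1.le hs.2).le

theorem nonpos_of_hasDerivAt_of_forall_lt {φ : ℝ → ℝ} {t d : ℝ} (ht : 0 < t)
    (hd : HasDerivAt φ d t) (h0 : φ t = 0) (h : ∀ s, 0 ≤ s → s < t → 0 < φ s) : d ≤ 0 := by
  have hs : Tendsto (slope φ t) (𝓝[<] t) (𝓝 d) :=
    hd.tendsto_slope.mono_left (nhdsWithin_mono _ fun s (hs : s < t) ↦ hs.ne)
  refine le_of_tendsto hs ?_
  filter_upwards [Ioo_mem_nhdsLT ht] with s hs
  rw [slope_def_field, h0, sub_zero]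
  exact div_nonpos_of_nonneg_of_nonpos (h s hs.1.le hs.2).le (by linarith [hs.2])

/-! ### A priori bound and obstruction to escape -/

namespace LienardOrbit

variable {P Q : Polynomial ℝ} {X Y k : ℝ → ℝ}

/-- As long as `x` stays bounded and `y` positive, `y` stays bounded. -/
theorem exists_snd_le (h : LienardOrbit P Q X Y k) {T c M : ℝ} (hT : 0 ≤ T) (hc : 0 < c)
    (hY : ∀ t, T ≤ t → c ≤ Y t) (hX : ∀ t, T ≤ t → X t ≤ M) :
    ∃ N, ∀ t, T ≤ t → Y t ≤ N := by
  have hmono : ∀ t, T ≤ t → X T ≤ X t := fun t ht ↦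
    le_of_hasDerivAt_nonneg (fun s hs ↦ h.hasDerivAt_fst s (hT.trans hs))
      (fun s hs ↦ mul_nonneg (h.speed_pos s (hT.trans hs)).le (hc.le.trans (hY s hs))) le_rfl ht
  obtain ⟨K₁, hK₁⟩ := (isCompact_Icc (a := X T) (b := M)).exists_bound_of_continuousOn
    P.continuous.continuousOn
  obtain ⟨K₂, hK₂⟩ := (isCompact_Icc (a := X T) (b := M)).exists_bound_of_continuousOn
    Q.continuous.continuousOn
  -- Along the orbit dy/dx = P/y + Q, which is at most this constant when y ≥ c.
  set K := K₁ / c + K₂ with hK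
  have hK₁0 : 0 ≤ K₁ := (norm_nonneg _).trans (hK₁ (X T) ⟨le_rfl, hX T le_rfl⟩)
  have hdec : ∀ t, T ≤ t → Y t - K * X t ≤ Y T - K * X T := by
    intro t ht
    refine le_of_hasDerivAt_nonpos (f := fun t ↦ Y t - K * X t) (fun s hs ↦
      (h.hasDerivAt_snd s (hT.trans hs)).sub
        ((h.hasDerivAt_fst s (hT.trans hs)).const_mul K)) (fun s hs ↦ ?_) le_rfl ht
    have hmem : X s ∈ Set.Icc (X T) M := ⟨hmono s hs, hX s hs⟩
    have hP := le_of_abs_le (hK₁ _ hmem)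
    have hQ := le_of_abs_le (hK₂ _ hmem)
    have hYs := hY s hs
    have h1 : K₁ ≤ K₁ / c * Y s := by
      rw [div_mul_eq_mul_div, le_div_iff₀ hc]
      exact mul_le_mul_of_nonneg_left hYs hK₁0
    have h2 : Q.eval (X s) * Y s ≤ K₂ * Y s :=
      mul_le_mul_of_nonneg_right hQ (hc.le.trans hYs)
    have h3 : P.eval (X s) + Q.eval (X s) * Y s - K * Y s ≤ 0 := by
      rw [hK, add_mul]
      linarith
    have := mul_nonpos_of_nonneg_of_nonpos (h.speed_pos s (hT.trans hs)).le h3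
    linarith
  refine ⟨Y T - K * X T + |K| * max |X T| |M|, fun t ht ↦ ?_⟩
  have hXt : |X t| ≤ max |X T| |M| := by
    refine abs_le.2 ⟨?_, (hX t ht).trans ((le_abs_self _).trans (le_max_right _ _))⟩
    have := neg_abs_le (X T)
    have := le_max_left |X T| |M|
    linarith [hmono t ht]
  have : K * X t ≤ |K| * max |X T| |M| :=
    (le_abs_self _).trans (by rw [abs_mul]; exact mul_le_mul_of_nonneg_left hXt (abs_nonneg _))
  linarith [hdec t ht]

/-- If `x (Q + δ x ^ m) ^ 2 + 4 (m + 1) P` is nonpositive for large `x`, then no orbit goes off to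
the right in the upper half plane. -/
theorem false_of_tendsto_atTop (h : LienardOrbit P Q X Y k) {m : ℕ} {δ : ℝ} (hδ : 0 < δ)
    (hR : ∀ᶠ x in atTop, x * (Q.eval x + δ * x ^ m) ^ 2 + 4 * (m + 1) * P.eval x ≤ 0)
    (hX : Tendsto X atTop atTop) (hY : ∀ᶠ t in atTop, 0 < Y t) : False := by
  obtain ⟨T, hT⟩ := eventually_atTop.1 ((((hX.eventually hR).and hY).and
    (hX.eventually (eventually_gt_atTop 0))).and (eventually_ge_atTop 0))
  have hd : ∀ t, T ≤ t → HasDerivAt (fun t ↦ Y t / X t ^ (m + 1) + δ * Real.log (X t))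
      (k t / X t ^ (m + 2) * (X t * P.eval (X t) + X t * (Q.eval (X t) + δ * X t ^ m) * Y t -
        (m + 1) * Y t ^ 2)) t := by
    intro t ht
    obtain ⟨⟨⟨-, -⟩, hx⟩, h0⟩ := hT t ht
    have hXd := h.hasDerivAt_fst t h0
    have := ((h.hasDerivAt_snd t h0).div (hXd.pow (m + 1)) (pow_pos hx _).ne').add
      ((hXd.log hx.ne').const_mul δ)
    convert! this using 1
    simp only [Pi.pow_apply, Nat.cast_add, Nat.cast_one, Nat.add_sub_cancel]
    field_simp
    ring
  have hle : ∀ t, T ≤ t →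
      Y t / X t ^ (m + 1) + δ * Real.log (X t) ≤ Y T / X T ^ (m + 1) + δ * Real.log (X T) := by
    intro t ht
    refine le_of_hasDerivAt_nonpos (f := fun t ↦ Y t / X t ^ (m + 1) + δ * Real.log (X t)) hd
      (fun s hs ↦ ?_) le_rfl ht
    obtain ⟨⟨⟨hr, hy⟩, hx⟩, h0⟩ := hT s hs
    refine mul_nonpos_of_nonneg_of_nonpos
      (div_nonneg (h.speed_pos s h0).le (pow_pos hx _).le) ?_
    -- Completing the square in y: with R = Q + δ x^m, 4(m+1) times the bracket is x (x R² + 4(m+1)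
    -- P) - (2(m+1) y - x R)².
    have hm : (0 : ℝ) < 4 * (m + 1) := by positivity
    refine nonpos_of_mul_nonpos_right (a := 4 * ((m : ℝ) + 1)) ?_ hm
    have h1 := mul_nonpos_of_nonneg_of_nonpos hx.le hr
    have h2 := sq_nonneg (2 * (m + 1) * Y s - X s * (Q.eval (X s) + δ * X s ^ m))
    nlinarith
  have hlog : Tendsto (fun t ↦ δ * Real.log (X t)) atTop atTop :=
    (Real.tendsto_log_atTop.comp hX).const_mul_atTop hδ
  obtain ⟨t, ht, ht'⟩ := ((hlog.eventually_gt_atTop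
    (Y T / X T ^ (m + 1) + δ * Real.log (X T))).and (eventually_ge_atTop T)).exists
  obtain ⟨⟨⟨-, hy⟩, hx⟩, -⟩ := hT t ht'
  have := div_pos hy (pow_pos hx (m + 1))
  linarith [hle t ht']

end LienardOrbit

/-! ### Orbits above a barrier -/

namespace CompleteLienardOrbit

variable {P Q : Polynomial ℝ} {X Y k : ℝ → ℝ}

/-- Since x is nondecreasing, a bound on x would bound y by `exists_snd_le`. The speed would then be
bounded below, and x would grow at least linearly. -/
theorem tendsto_fst (h : CompleteLienardOrbit P Q X Y k) {c : ℝ} (hc : 0 < c)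
    (hY : ∀ t, 0 ≤ t → c ≤ Y t) : Tendsto X atTop atTop := by
  have hmono : ∀ s t, 0 ≤ s → s ≤ t → X s ≤ X t := fun s t hs hst ↦
    le_of_hasDerivAt_nonneg h.hasDerivAt_fst
      (fun s hs ↦ mul_nonneg (h.speed_pos s hs).le (hc.le.trans (hY s hs))) hs hst
  refine tendsto_atTop.2 fun M ↦ ?_
  suffices ∃ t, 0 ≤ t ∧ M ≤ X t by
    obtain ⟨t, ht, hM⟩ := this
    filter_upwards [eventually_ge_atTop t] with s hs
    exact hM.trans (hmono t s ht hs)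
  by_contra! hcon
  obtain ⟨N, hN⟩ := h.exists_snd_le le_rfl hc hY (fun t ht ↦ (hcon t ht).le)
  obtain ⟨δ, hδ, hk⟩ := h.speed_bound (max (max |X 0| |M|) N)
  have hkt : ∀ t, 0 ≤ t → δ ≤ k t := by
    intro t ht
    refine hk t ht ?_ ?_
    · refine le_trans (abs_le.2 ⟨?_, ?_⟩) (le_max_left _ _)
      · have := neg_abs_le (X 0)
        have := le_max_left |X 0| |M|
        linarith [hmono 0 t le_rfl ht]
      · exact (hcon t ht).le.trans ((le_abs_self _).trans (le_max_right _ _))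
    · rw [abs_of_pos (hc.trans_le (hY t ht))]
      exact (hN t ht).trans (le_max_right _ _)
  have hgrow : ∀ t, 0 ≤ t → X 0 + δ * c * t ≤ X t := by
    intro t ht
    have := le_of_hasDerivAt_nonneg (f := fun t ↦ X t - δ * c * t)
      (fun s hs ↦ (h.hasDerivAt_fst s hs).sub ((hasDerivAt_id s).const_mul (δ * c)))
      (fun s hs ↦ by
        have := mul_le_mul (hkt s hs) (hY s hs) hc.le (h.speed_pos s hs).le
        linarith) le_rfl ht
    simp only [mul_zero, sub_zero] at this
    linarith
  have hδc := mul_pos hδ hc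
  have ht : 0 ≤ (M - X 0) / (δ * c) := div_nonneg (by linarith [hcon 0 le_rfl]) hδc.le
  have h1 := hgrow _ ht
  rw [mul_div_cancel₀ _ hδc.ne'] at h1
  linarith [hcon _ ht]

/-- An orbit that starts above a barrier `y = g x` stays above it. -/
theorem lt_snd_of_barrier (h : CompleteLienardOrbit P Q X Y k) {g g' : ℝ → ℝ} {x₀ : ℝ}
    (hg : ∀ x, x₀ ≤ x → HasDerivAt g (g' x) x) (hpos : ∀ x, x₀ ≤ x → 0 < g x)
    (hbar : ∀ x, x₀ ≤ x → g x * g' x < P.eval x + Q.eval x * g x)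
    (hX : X 0 = x₀) (hY : g x₀ < Y 0) : ∀ t, 0 ≤ t → x₀ ≤ X t ∧ g (X t) < Y t := by
  -- The maximum keeps the argument of g in the range where g is controlled, before it is known that
  -- the orbit stays to the right of x₀. At a first zero of φ the barrier inequality gives a
  -- positive derivative, a contradiction.
  set φ : ℝ → ℝ := fun t ↦ Y t - g (max x₀ (X t)) with hφ
  have hmono : ∀ t, 0 ≤ t → (∀ s, 0 ≤ s → s < t → 0 < φ s) → ∀ s, 0 ≤ s → s < t → 0 < Y s := by
    intro t _ hs s hs0 hst
    have h1 := hs s hs0 hst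
    have h2 := hpos (max x₀ (X s)) (le_max_left _ _)
    simp only [hφ] at h1
    linarith
  have hXlt : ∀ t, 0 < t → (∀ s, 0 ≤ s → s < t → 0 < φ s) → x₀ < X t := by
    intro t ht hs
    rw [← hX]
    have hY := hmono t ht.le hs
    have hsm : StrictMonoOn X (Set.Icc 0 t) := by
      refine strictMonoOn_of_hasDerivWithinAt_pos (f' := fun s ↦ k s * Y s) (convex_Icc 0 t)
        (fun s hs ↦ (h.hasDerivAt_fst s hs.1).continuousAt.continuousWithinAt)
        (fun s hs ↦ (h.hasDerivAt_fst s (interior_subset hs).1).hasDerivWithinAt) fun s hs ↦ ?_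
      rw [interior_Icc] at hs
      exact mul_pos (h.speed_pos s hs.1.le) (hY s hs.1.le hs.2)
    exact hsm ⟨le_rfl, ht.le⟩ ⟨ht.le, le_rfl⟩ ht
  have hall : ∀ t, 0 ≤ t → 0 < φ t := by
    refine pos_of_no_first_zero (fun t ht ↦ ?_) (by simp [hφ, hX, hY]) fun t ht h0 hs ↦ ?_
    · refine (h.hasDerivAt_snd t ht).continuousAt.sub ?_
      have hm : ContinuousAt (fun t ↦ max x₀ (X t)) t :=
        continuousAt_const.max (h.hasDerivAt_fst t ht).continuousAt
      exact ContinuousAt.comp (f := fun t ↦ max x₀ (X t)) (g := g)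
        (hg _ (le_max_left _ _)).continuousAt hm
    · have hx := hXlt t ht hs
      have hXd := h.hasDerivAt_fst t ht.le
      have hev : φ =ᶠ[𝓝 t] fun t ↦ Y t - g (X t) := by
        filter_upwards [hXd.continuousAt.eventually_const_lt hx] with s hs
        simp [hφ, max_eq_right hs.le]
      have hd := ((h.hasDerivAt_snd t ht.le).sub
        ((hg (X t) hx.le).comp t hXd)).congr_of_eventuallyEq hev
      have hle := nonpos_of_hasDerivAt_of_forall_lt ht hd h0 hs
      have hYt : Y t = g (X t) := by
        have := hev.eq_of_nhds
        rw [h0] at this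
        linarith
      rw [hYt] at hle
      have hpos' := mul_pos (h.speed_pos t ht.le) (sub_pos.2 (hbar (X t) hx.le))
      nlinarith
  intro t ht
  have hx : x₀ ≤ X t := by
    rcases ht.eq_or_lt with rfl | ht
    · exact hX.ge
    · exact (hXlt t ht fun s hs _ ↦ hall s hs).le
  refine ⟨hx, ?_⟩
  have := hall t ht
  simp only [hφ, max_eq_right hx] at this
  linarith

end CompleteLienardOrbit

/-! ### Construction of escaping orbits -/

/-- There is an initial point whose orbit goes off to the right and has a limit direction. -/
def HasEscapingOrbit (P Q : Polynomial ℝ) : Prop :=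
  ∃ x₀ y₀ e₀ e₁ : ℝ, ∀ X Y k : ℝ → ℝ, CompleteLienardOrbit P Q X Y k → X 0 = x₀ → Y 0 = y₀ →
    Tendsto X atTop atTop ∧
      Tendsto (fun t ↦ X t / √(1 + X t ^ 2 + Y t ^ 2)) atTop (𝓝 e₀) ∧
      Tendsto (fun t ↦ Y t / √(1 + X t ^ 2 + Y t ^ 2)) atTop (𝓝 e₁)

theorem tendsto_direction_of_slope_atTop {X Y : ℝ → ℝ} (hX : Tendsto X atTop atTop)
    (hYX : Tendsto (fun t ↦ Y t / X t) atTop atTop) :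
    Tendsto (fun t ↦ X t / √(1 + X t ^ 2 + Y t ^ 2)) atTop (𝓝 0) ∧
      Tendsto (fun t ↦ Y t / √(1 + X t ^ 2 + Y t ^ 2)) atTop (𝓝 1) := by
  have hX0 := hX.eventually_gt_atTop 0
  have hY : Tendsto Y atTop atTop := by
    refine (hYX.atTop_mul_atTop₀ hX).congr' ?_
    filter_upwards [hX0] with t ht
    field_simp
  have hY0 := hY.eventually_gt_atTop 0
  have hu : Tendsto (fun t ↦ (Y t)⁻¹) atTop (𝓝 0) := hY.inv_tendsto_atTop
  have hv : Tendsto (fun t ↦ (Y t / X t)⁻¹) atTop (𝓝 0) := hYX.inv_tendsto_atTop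
  have hs : Tendsto (fun t ↦ √((Y t)⁻¹ ^ 2 + (Y t / X t)⁻¹ ^ 2 + 1)) atTop (𝓝 1) := by
    have := (((hu.pow 2).add (hv.pow 2)).add_const 1).sqrt
    simpa using this
  have hρ : ∀ᶠ t in atTop, √(1 + X t ^ 2 + Y t ^ 2) =
      Y t * √((Y t)⁻¹ ^ 2 + (Y t / X t)⁻¹ ^ 2 + 1) := by
    filter_upwards [hX0, hY0] with t hx hy
    have : 1 + X t ^ 2 + Y t ^ 2 = Y t ^ 2 * ((Y t)⁻¹ ^ 2 + (Y t / X t)⁻¹ ^ 2 + 1) := by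
      field_simp
    rw [this, Real.sqrt_mul (sq_nonneg _), Real.sqrt_sq hy.le]
  constructor
  · have := hv.div hs one_ne_zero
    rw [zero_div] at this
    refine this.congr' ?_
    filter_upwards [hX0, hY0, hρ] with t hx hy ht
    rw [Pi.div_apply, ht, inv_div, div_div]
  · have := hs.inv₀ one_ne_zero
    rw [inv_one] at this
    refine this.congr' ?_
    filter_upwards [hX0, hY0, hρ] with t hx hy ht
    rw [ht]
    field_simp

theorem tendsto_direction_of_slope {X Y : ℝ → ℝ} {l : ℝ} (hX : Tendsto X atTop atTop)
    (hYX : Tendsto (fun t ↦ Y t / X t) atTop (𝓝 l)) :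
    Tendsto (fun t ↦ X t / √(1 + X t ^ 2 + Y t ^ 2)) atTop (𝓝 (√(1 + l ^ 2))⁻¹) ∧
      Tendsto (fun t ↦ Y t / √(1 + X t ^ 2 + Y t ^ 2)) atTop (𝓝 (l * (√(1 + l ^ 2))⁻¹)) := by
  have hX0 := hX.eventually_gt_atTop 0
  have hu : Tendsto (fun t ↦ (X t)⁻¹) atTop (𝓝 0) := hX.inv_tendsto_atTop
  have hs : Tendsto (fun t ↦ √((X t)⁻¹ ^ 2 + 1 + (Y t / X t) ^ 2)) atTop (𝓝 √(1 + l ^ 2)) := by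
    have := (((hu.pow 2).add_const 1).add (hYX.pow 2)).sqrt
    simpa using this
  have hl : √(1 + l ^ 2) ≠ 0 := (Real.sqrt_pos.2 (by positivity)).ne'
  have h1 : Tendsto (fun t ↦ X t / √(1 + X t ^ 2 + Y t ^ 2)) atTop (𝓝 (√(1 + l ^ 2))⁻¹) := by
    refine (hs.inv₀ hl).congr' ?_
    filter_upwards [hX0] with t hx
    have : 1 + X t ^ 2 + Y t ^ 2 = X t ^ 2 * ((X t)⁻¹ ^ 2 + 1 + (Y t / X t) ^ 2) := by
      field_simp
    rw [this, Real.sqrt_mul (sq_nonneg _), Real.sqrt_sq hx.le]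
    field_simp
  refine ⟨h1, (hYX.mul h1).congr' ?_⟩
  filter_upwards [hX0] with t hx
  field_simp

/-- Above the barrier y ≥ g(x) ≥ 1 forces x → ∞, and then y/x ≥ g(x)/x → ∞, so the limit direction
is (0, 1). -/
theorem hasEscapingOrbit_of_barrier {P Q : Polynomial ℝ} {g g' : ℝ → ℝ}
    (hg : ∀ᶠ x in atTop, HasDerivAt g (g' x) x)
    (hbar : ∀ᶠ x in atTop, g x * g' x < P.eval x + Q.eval x * g x)
    (hgx : Tendsto (fun x ↦ g x / x) atTop atTop) : HasEscapingOrbit P Q := by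
  obtain ⟨x₀, hx₀⟩ := eventually_atTop.1
    (((hg.and hbar).and (hgx.eventually_ge_atTop 1)).and (eventually_ge_atTop 1))
  have hge : ∀ x, x₀ ≤ x → 1 ≤ g x := by
    intro x hx
    obtain ⟨⟨-, h1⟩, h2⟩ := hx₀ x hx
    rw [one_le_div (by linarith)] at h1
    linarith
  refine ⟨x₀, g x₀ + 1, 0, 1, fun X Y k h hX hY ↦ ?_⟩
  have hlt := h.lt_snd_of_barrier (fun x hx ↦ (hx₀ x hx).1.1.1)
    (fun x hx ↦ zero_lt_one.trans_le (hge x hx)) (fun x hx ↦ (hx₀ x hx).1.1.2) hX (by linarith)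
  have hXt : Tendsto X atTop atTop := h.tendsto_fst one_pos fun t ht ↦
    (hge _ (hlt t ht).1).trans (hlt t ht).2.le
  refine ⟨hXt, tendsto_direction_of_slope_atTop hXt (tendsto_atTop_mono' _ ?_ (hgx.comp hXt))⟩
  filter_upwards [eventually_ge_atTop 0, hXt.eventually_gt_atTop 0] with t ht hx
  exact div_le_div_of_nonneg_right (hlt t ht).2.le hx.le

/-- As Q is a constant b, the difference y - (l x + μ) solves a linear equation and stays 0. On the
line y' = k l y, so y never falls below its positive initial value. -/
theorem hasEscapingOrbit_of_line {P Q : Polynomial ℝ} {l μ : ℝ} (hl : 0 ≤ l) (x₀ : ℝ)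
    (hy : 0 < l * x₀ + μ)
    (hQ : Q.natDegree = 0)
    (hline : ∀ x, l * (l * x + μ) = P.eval x + Q.eval x * (l * x + μ)) :
    HasEscapingOrbit P Q := by
  refine ⟨x₀, l * x₀ + μ, (√(1 + l ^ 2))⁻¹, l * (√(1 + l ^ 2))⁻¹, fun X Y k h hX hY ↦ ?_⟩
  obtain ⟨b, rfl⟩ := Polynomial.natDegree_eq_zero.1 hQ
  simp only [Polynomial.eval_C] at hline
  have hYX : ∀ t, 0 ≤ t → Y t = l * X t + μ := by
    intro t ht
    have hd : ∀ t ∈ Set.Ici (0 : ℝ), HasDerivAt (fun t ↦ Y t - (l * X t + μ))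
        ((k t * (b - l)) * (Y t - (l * X t + μ))) t := by
      intro t ht
      have := (h.hasDerivAt_snd t ht).sub (((h.hasDerivAt_fst t ht).const_mul l).add_const μ)
      convert! this using 1
      have := hline (X t)
      rw [Polynomial.eval_C]
      linear_combination (k t) * this
    have := eq_mul_exp_of_hasDerivAt_mul (convex_Ici 0) Set.self_mem_Ici
      (h.speed_continuous.mul continuous_const) hd t ht
    simp only [hX, hY, sub_self, zero_mul] at this
    linarith
  have hYge : ∀ t, 0 ≤ t → l * x₀ + μ ≤ Y t := by
    intro t ht
    have hd : ∀ t ∈ Set.Ici (0 : ℝ), HasDerivAt Y ((k t * l) * Y t) t := by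
      intro t ht
      have := h.hasDerivAt_snd t ht
      rwa [hYX t ht, Polynomial.eval_C, ← hline, ← mul_assoc, ← hYX t ht] at this
    have hexp := eq_mul_exp_of_hasDerivAt_mul (convex_Ici 0) Set.self_mem_Ici
      (h.speed_continuous.mul continuous_const) hd
    have hpos : ∀ t, 0 ≤ t → 0 < Y t := fun t ht ↦ by
      rw [hexp t ht, hY]
      exact mul_pos hy (Real.exp_pos _)
    rw [← hY]
    exact le_of_hasDerivAt_nonneg hd (fun s hs ↦ mul_nonneg
      (mul_nonneg (h.speed_pos s hs).le hl) (hpos s hs).le) le_rfl ht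
  have hXt := h.tendsto_fst hy hYge
  refine ⟨hXt, tendsto_direction_of_slope hXt ?_⟩
  have hlim : Tendsto (fun t ↦ l + μ * (X t)⁻¹) atTop (𝓝 l) := by
    have := (hXt.inv_tendsto_atTop.const_mul μ).const_add l
    simpa using this
  refine hlim.congr' ?_
  filter_upwards [eventually_ge_atTop 0, hXt.eventually_gt_atTop 0] with t ht hx
  rw [hYX t ht]
  field_simp

/-- The barrier `c x ^ (m + 1)`. -/
theorem hasEscapingOrbit_of_pow_barrier {P Q : Polynomial ℝ} {m : ℕ} (hm : 1 ≤ m) {c : ℝ}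
    (hc : 0 < c)
    (h : ∀ᶠ x in atTop, 0 < P.eval x / x ^ (2 * m + 1) + c * (Q.eval x / x ^ m) -
      (m + 1) * c ^ 2) :
    HasEscapingOrbit P Q := by
  refine hasEscapingOrbit_of_barrier (g := fun x ↦ c * x ^ (m + 1))
    (g' := fun x ↦ c * ((m + 1 : ℕ) * x ^ m)) (Eventually.of_forall fun x ↦ ?_) ?_ ?_
  · exact (hasDerivAt_pow (m + 1) x).const_mul c
  · filter_upwards [h, eventually_gt_atTop 0] with x hx h0
    have := mul_pos hx (pow_pos h0 (2 * m + 1))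
    have e : (P.eval x / x ^ (2 * m + 1) + c * (Q.eval x / x ^ m) - (m + 1) * c ^ 2) *
        x ^ (2 * m + 1) = P.eval x + Q.eval x * (c * x ^ (m + 1)) -
          c * x ^ (m + 1) * (c * ((m + 1 : ℕ) * x ^ m)) := by
      push_cast
      field_simp
      ring
    linarith
  · refine ((tendsto_pow_atTop (by omega : m ≠ 0)).const_mul_atTop hc).congr' ?_
    filter_upwards [eventually_gt_atTop 0] with x h0
    field_simp
    ring

/-- This covers constant Q, where the barrier c x has bounded slope. With g = (√a / 2) x^(3/2) one
has g g' = (3/8) a x² < P, while Q g > 0 and g(x)/x → ∞. -/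
theorem hasEscapingOrbit_of_sqrt_barrier {P Q : Polynomial ℝ} {a : ℝ} (ha : 0 < a)
    (hP : ∀ᶠ x in atTop, a * x ^ 2 ≤ P.eval x) (hQ : ∀ᶠ x in atTop, 0 < Q.eval x) :
    HasEscapingOrbit P Q := by
  have hsa := Real.sqrt_pos.2 ha
  refine hasEscapingOrbit_of_barrier (g := fun x ↦ √a / 2 * (x * √x))
    (g' := fun x ↦ √a / 2 * (1 * √x + x * (1 / (2 * √x)))) ?_ ?_ ?_
  · filter_upwards [eventually_gt_atTop 0] with x h0
    exact ((hasDerivAt_id x).mul (Real.hasDerivAt_sqrt h0.ne')).const_mul _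
  · filter_upwards [hP, hQ, eventually_gt_atTop 0] with x hp hq h0
    have hs := Real.sqrt_pos.2 h0
    have hs2 := Real.sq_sqrt h0.le
    have ha2 := Real.sq_sqrt ha.le
    have e : √a / 2 * (x * √x) * (√a / 2 * (1 * √x + x * (1 / (2 * √x)))) =
        3 / 8 * (a * x ^ 2) := by
      field_simp
      rw [ha2, hs2]
      ring
    rw [e]
    have : 0 < Q.eval x * (√a / 2 * (x * √x)) := by positivity
    have : 0 < a * x ^ 2 := by positivity
    linarith
  · refine (Real.tendsto_sqrt_atTop.const_mul_atTop (half_pos hsa)).congr' ?_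
    filter_upwards [eventually_gt_atTop 0] with x h0
    field_simp

/-- The degenerate case of a double root `c` needs the barrier `c x ^ (m + 1) + x ^ (m + 1 / 2)`. -/
theorem hasEscapingOrbit_of_double_root {P Q : Polynomial ℝ} {m : ℕ} (hm : 1 ≤ m) {c : ℝ}
    (hc : 0 < c) (hP : P.natDegree ≤ 2 * m + 1) (hQ : Q.natDegree ≤ m)
    (hb : Q.coeff m = 2 * (m + 1) * c) (ha : P.coeff (2 * m + 1) = -((m + 1) * c ^ 2)) :
    HasEscapingOrbit P Q := by
  obtain ⟨j, rfl⟩ : ∃ j, m = j + 1 := ⟨m - 1, by omega⟩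
  set p := P - Polynomial.monomial (2 * (j + 1) + 1) (P.coeff (2 * (j + 1) + 1)) with hp
  set q := Q - Polynomial.monomial (j + 1) (Q.coeff (j + 1)) with hq
  have hpd : p.natDegree ≤ 2 * (j + 1) := by
    refine Polynomial.natDegree_le_iff_coeff_eq_zero.2 fun N hN ↦ ?_
    rw [hp, Polynomial.coeff_sub, Polynomial.coeff_monomial]
    split_ifs with h
    · rw [h, sub_self]
    · rw [Polynomial.coeff_eq_zero_of_natDegree_lt (by omega), sub_zero]
  have hqd : q.natDegree ≤ j := by
    refine Polynomial.natDegree_le_iff_coeff_eq_zero.2 fun N hN ↦ ?_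
    rw [hq, Polynomial.coeff_sub, Polynomial.coeff_monomial]
    split_ifs with h
    · rw [h, sub_self]
    · rw [Polynomial.coeff_eq_zero_of_natDegree_lt (by omega), sub_zero]
  have hPe : ∀ x, P.eval x = p.eval x - ((j + 1 : ℕ) + 1) * c ^ 2 * x ^ (2 * (j + 1) + 1) := by
    intro x
    rw [hp, Polynomial.eval_sub, Polynomial.eval_monomial, ha]
    ring
  have hQe : ∀ x, Q.eval x = q.eval x + 2 * ((j + 1 : ℕ) + 1) * c * x ^ (j + 1) := by
    intro x
    rw [hq, Polynomial.eval_sub, Polynomial.eval_monomial, hb]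
    ring
  refine hasEscapingOrbit_of_barrier (g := fun x ↦ x ^ (j + 1) * (c * x + √x))
    (g' := fun x ↦ ((j + 1 : ℕ) * x ^ j) * (c * x + √x) + x ^ (j + 1) * (c * 1 + 1 / (2 * √x)))
    ?_ ?_ ?_
  · filter_upwards [eventually_gt_atTop 0] with x h0
    exact (hasDerivAt_pow (j + 1) x).mul
      (((hasDerivAt_id x).const_mul c).add (Real.hasDerivAt_sqrt h0.ne'))
  · have hs : Tendsto (fun x : ℝ ↦ (√x)⁻¹) atTop (𝓝 0) :=
      Real.tendsto_sqrt_atTop.inv_tendsto_atTop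
    -- This is P + Q g - g g' divided by x^(2m) √x, m = j + 1. The terms in x^(2m+1) cancel at the
    -- double root; the next coefficient is 2(m+1) c - (2m + 3/2) c = c/2 > 0.
    have hlim : Tendsto (fun x ↦ c / 2 + (p.eval x / x ^ (2 * (j + 1))) * (√x)⁻¹ +
        (q.eval x / x ^ j) * (c + (√x)⁻¹) * (√x)⁻¹ - (j + 1 + 1 / 2) * (√x)⁻¹) atTop
        (𝓝 (c / 2)) := by
      have := ((((p.tendsto_eval_div_pow hpd).mul hs).const_add (c / 2)).add
        (((q.tendsto_eval_div_pow hqd).mul (hs.const_add c)).mul hs)).sub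
          (hs.const_mul ((j : ℝ) + 1 + 1 / 2))
      simpa using this
    filter_upwards [hlim.eventually_const_lt (half_pos hc), eventually_gt_atTop 0] with x hx h0
    have hs0 := Real.sqrt_pos.2 h0
    have hsq := Real.sq_sqrt h0.le
    have hpos := mul_pos hx (mul_pos (pow_pos h0 (2 * (j + 1))) hs0)
    rw [hPe, hQe, ← sub_pos]
    refine hpos.trans_eq ?_
    push_cast
    generalize p.eval x = A
    generalize q.eval x = B
    generalize √x = s at *
    subst hsq
    field_simp
    ring
  · have hmain : Tendsto (fun x : ℝ ↦ c * x ^ (j + 1)) atTop atTop :=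
      (tendsto_pow_atTop (by omega : j + 1 ≠ 0)).const_mul_atTop hc
    refine tendsto_atTop_mono' _ ?_ hmain
    filter_upwards [eventually_gt_atTop 0] with x h0
    rw [le_div_iff₀ h0]
    have := mul_nonneg (pow_pos h0 (j + 1)).le (Real.sqrt_nonneg x)
    nlinarith

/-- The horizontal line y = -a/b, on which y' = 0, is invariant and lies in the upper half plane. -/
theorem hasEscapingOrbit_of_const {a b : ℝ} (ha : 0 < a) (hb : b < 0) :
    HasEscapingOrbit (Polynomial.C a) (Polynomial.C b) := by
  refine hasEscapingOrbit_of_line (l := 0) (μ := -a / b) le_rfl 0 ?_ (Polynomial.natDegree_C b)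
    fun x ↦ ?_
  · have := div_pos_of_neg_of_neg (neg_lt_zero.2 ha) hb
    linarith
  · have := hb.ne
    simp only [Polynomial.eval_C]
    field_simp
    ring

/-- The slope l is the larger root of l² = b l + a₁, hence positive; l = b would force a₁ = 0, so μ
= a₀/(l - b) makes sense. The starting point is the one of height 1 on the line. -/
theorem hasEscapingOrbit_of_linear {P Q : Polynomial ℝ} (hP : P.natDegree = 1)
    (hQ : Q.natDegree = 0) (ha : P.coeff 1 ≠ 0) (hb : 0 < Q.coeff 0)
    (hdisc : 0 ≤ Q.coeff 0 ^ 2 + 4 * P.coeff 1) : HasEscapingOrbit P Q := by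
  obtain ⟨b, rfl⟩ := Polynomial.natDegree_eq_zero.1 hQ
  simp only [Polynomial.coeff_C_zero] at hb hdisc
  obtain ⟨a₁, a₀, rfl⟩ : ∃ a₁ a₀, P = Polynomial.C a₁ * Polynomial.X + Polynomial.C a₀ :=
    Polynomial.exists_eq_X_add_C_of_natDegree_le_one hP.le
  simp only [Polynomial.coeff_add, Polynomial.coeff_C_mul, Polynomial.coeff_X_one, mul_one,
    Polynomial.coeff_C_succ, add_zero] at ha hdisc
  have hsq := Real.sq_sqrt hdisc
  have hs0 := Real.sqrt_nonneg (b ^ 2 + 4 * a₁)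
  set l := (b + √(b ^ 2 + 4 * a₁)) / 2 with hl
  have hlpos : 0 < l := by rw [hl]; linarith
  have hroot : l ^ 2 = b * l + a₁ := by
    rw [hl]
    linear_combination hsq / 4
  have hne : l - b ≠ 0 := by
    intro h
    have : l = b := by linarith
    rw [this] at hroot
    exact ha (by linarith)
  refine hasEscapingOrbit_of_line (l := l) (μ := a₀ / (l - b)) hlpos.le
    ((1 - a₀ / (l - b)) / l) ?_ (Polynomial.natDegree_C b) fun x ↦ ?_
  · rw [mul_div_cancel₀ _ hlpos.ne']
    linarith
  · simp only [Polynomial.eval_add, Polynomial.eval_mul, Polynomial.eval_C, Polynomial.eval_X]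
    have : (l - b) * (a₀ / (l - b)) = a₀ := mul_div_cancel₀ _ hne
    linear_combination x * hroot + this

/-- If `b > 0`, and `a > 0` or `ℓ₀` is odd, then some orbit escapes when neither of the
monodromy conditions holds. -/
theorem hasEscapingOrbit_of_not {P Q : Polynomial ℝ} {ℓ₀ ℓ₁ : ℕ} (hP : P.natDegree = ℓ₀)
    (hQ : Q.natDegree = ℓ₁) (ha : P.coeff ℓ₀ ≠ 0) (hb : 0 < Q.coeff ℓ₁)
    (hsign : 0 < P.coeff ℓ₀ ∨ Odd ℓ₀) (hdeg : ℓ₀ ≠ 0 ∨ ℓ₁ ≠ 0)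
    (h₁ : ¬(Odd ℓ₀ ∧ ℓ₀ > 2 * ℓ₁ + 1 ∧ P.coeff ℓ₀ < 0))
    (h₂ : ¬(ℓ₀ = 2 * ℓ₁ + 1 ∧ Q.coeff ℓ₁ ^ 2 + 2 * ((ℓ₀ : ℝ) + 1) * P.coeff ℓ₀ < 0)) :
    HasEscapingOrbit P Q := by
  have hdisc : ℓ₀ = 2 * ℓ₁ + 1 → 0 ≤ Q.coeff ℓ₁ ^ 2 + 4 * (ℓ₁ + 1) * P.coeff ℓ₀ := by
    intro h
    have := not_lt.1 fun h' ↦ h₂ ⟨h, h'⟩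
    rw [h] at this ⊢
    push_cast at this
    linarith
  have hQlim := Q.tendsto_eval_div_pow hQ.le
  rcases Nat.eq_zero_or_pos ℓ₁ with rfl | hℓ₁
  · by_cases h1 : ℓ₀ = 1
    · subst h1
      exact hasEscapingOrbit_of_linear hP hQ ha hb (by simpa using hdisc (by norm_num))
    · have h2 : 2 ≤ ℓ₀ := by omega
      -- A negative coefficient would make ℓ₀ odd and greater than 1, which is (L1).
      have hapos : 0 < P.coeff ℓ₀ := by
        rcases hsign with h | h
        · exact h
        · exact lt_of_le_of_ne (not_lt.1 fun h' ↦ h₁ ⟨h, by omega, h'⟩) ha.symm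
      refine hasEscapingOrbit_of_sqrt_barrier (half_pos hapos) ?_
        (Polynomial.eventually_eval_pos (by rwa [hQ]))
      filter_upwards [(P.tendsto_eval_div_pow hP.le).eventually_const_lt (half_lt_self hapos),
        eventually_ge_atTop 1] with x hx h1
      rw [lt_div_iff₀ (by positivity)] at hx
      have := mul_le_mul_of_nonneg_left (pow_le_pow_right₀ h1 h2) (half_pos hapos).le
      linarith
  · have hn : (0 : ℝ) < ℓ₁ + 1 := by positivity
    -- The maximizer of a + b c - (m+1) c²; the maximum is a + (m+1) c², the discriminant over
    -- 4(m+1).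
    set c := Q.coeff ℓ₁ / (2 * (ℓ₁ + 1)) with hc
    have hbc : Q.coeff ℓ₁ = 2 * (ℓ₁ + 1) * c := by
      rw [hc]
      field_simp
    have hcpos : 0 < c := by positivity
    by_cases hapos : 0 < P.coeff ℓ₀
    · have hPpos : ∀ᶠ x in atTop, 0 < P.eval x := Polynomial.eventually_eval_pos (by rwa [hP])
      refine hasEscapingOrbit_of_pow_barrier hℓ₁ hcpos ?_
      have hlt : (ℓ₁ + 1) * c < Q.coeff ℓ₁ := by
        rw [hbc]
        nlinarith
      filter_upwards [hQlim.eventually_const_lt hlt, hPpos, eventually_gt_atTop 0]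
        with x hq hp h0
      have := div_pos hp (pow_pos h0 (2 * ℓ₁ + 1))
      have := mul_lt_mul_of_pos_left hq hcpos
      nlinarith
    · have hodd : Odd ℓ₀ := hsign.resolve_left hapos
      have haneg : P.coeff ℓ₀ < 0 := lt_of_le_of_ne (not_lt.1 hapos) ha
      have hle : ℓ₀ ≤ 2 * ℓ₁ + 1 := not_lt.1 fun h ↦ h₁ ⟨hodd, h, haneg⟩
      -- When ℓ₀ < 2ℓ₁ + 1 the coefficient of x^(2ℓ₁+1) vanishes and the discriminant is just b².
      have hd : 0 ≤ Q.coeff ℓ₁ ^ 2 + 4 * (ℓ₁ + 1) * P.coeff (2 * ℓ₁ + 1) := by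
        rcases hle.lt_or_eq with h | h
        · rw [Polynomial.coeff_eq_zero_of_natDegree_lt (by omega : P.natDegree < 2 * ℓ₁ + 1)]
          positivity
        · rw [← h]
          exact hdisc h
      have hd' : 0 ≤ (ℓ₁ + 1) * c ^ 2 + P.coeff (2 * ℓ₁ + 1) := by
        rw [hbc] at hd
        have : 0 ≤ (4 * ((ℓ₁ : ℝ) + 1)) * ((ℓ₁ + 1) * c ^ 2 + P.coeff (2 * ℓ₁ + 1)) := by
          linarith
        exact nonneg_of_mul_nonneg_right this (by positivity)
      rcases hd'.eq_or_lt with h | h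
      · exact hasEscapingOrbit_of_double_root hℓ₁ hcpos (by omega) hQ.le hbc (by linarith)
      · refine hasEscapingOrbit_of_pow_barrier hℓ₁ hcpos ?_
        have := ((P.tendsto_eval_div_pow (by omega : P.natDegree ≤ 2 * ℓ₁ + 1)).add
          (hQlim.const_mul c)).sub_const ((ℓ₁ + 1) * c ^ 2)
        refine this.eventually_const_lt ?_
        rw [hbc]
        nlinarith

/-! ### No escape under the monodromy conditions -/

/-- The monodromy conditions give the differential inequality that forbids escape. -/
theorem exists_eventually_nonpos {P Q : Polynomial ℝ} {ℓ₀ ℓ₁ : ℕ} (hP : P.natDegree = ℓ₀)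
    (hQ : Q.natDegree = ℓ₁)
    (h : (Odd ℓ₀ ∧ ℓ₀ > 2 * ℓ₁ + 1 ∧ P.coeff ℓ₀ < 0) ∨
      (ℓ₀ = 2 * ℓ₁ + 1 ∧ Q.coeff ℓ₁ ^ 2 + 2 * ((ℓ₀ : ℝ) + 1) * P.coeff ℓ₀ < 0)) :
    ∃ δ > 0, ∀ᶠ x in atTop,
      x * (Q.eval x + δ * x ^ ℓ₁) ^ 2 + 4 * (ℓ₁ + 1) * P.eval x ≤ 0 := by
  have hQlim := Q.tendsto_eval_div_pow hQ.le
  suffices ∃ δ > 0, ∀ᶠ x in atTop,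
      (Q.eval x / x ^ ℓ₁ + δ) ^ 2 + 4 * (ℓ₁ + 1) * (P.eval x / x ^ (2 * ℓ₁ + 1)) ≤ 0 by
    obtain ⟨δ, hδ, h⟩ := this
    refine ⟨δ, hδ, ?_⟩
    filter_upwards [h, eventually_gt_atTop 0] with x hx h0
    have := mul_nonpos_of_nonneg_of_nonpos (pow_pos h0 (2 * ℓ₁ + 1)).le hx
    refine le_of_eq_of_le ?_ this
    field_simp
    ring
  rcases h with ⟨-, hlt, ha⟩ | ⟨heq, hd⟩
  · refine ⟨1, one_pos, ?_⟩
    have hPlim : Tendsto (fun x ↦ P.eval x / x ^ (2 * ℓ₁ + 1)) atTop atBot := by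
      have h1 := P.tendsto_eval_div_pow hP.le
      have h2 : Tendsto (fun x : ℝ ↦ x ^ (ℓ₀ - (2 * ℓ₁ + 1))) atTop atTop :=
        tendsto_pow_atTop (by omega)
      refine (h2.atTop_mul_neg ha h1).congr' ?_
      filter_upwards [eventually_gt_atTop 0] with x h0
      obtain ⟨j, rfl⟩ : ∃ j, ℓ₀ = 2 * ℓ₁ + 1 + j := ⟨ℓ₀ - (2 * ℓ₁ + 1), by omega⟩
      rw [Nat.add_sub_cancel_left, pow_add x (2 * ℓ₁ + 1) j]
      field_simp
    have hn : (0 : ℝ) < 4 * (ℓ₁ + 1) := by positivity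
    exact (((hQlim.add_const 1).pow 2).add_atBot (hPlim.const_mul_atBot hn)).eventually_le_atBot 0
  · subst heq
    -- At δ = 0 this is the strictly negative quantity of (L2), since 2(ℓ₀ + 1) = 4(ℓ₁ + 1);
    -- continuity leaves room for some δ > 0.
    have hcont : Tendsto (fun δ : ℝ ↦ (Q.coeff ℓ₁ + δ) ^ 2 +
        4 * (ℓ₁ + 1) * P.coeff (2 * ℓ₁ + 1)) (𝓝[>] 0)
        (𝓝 ((Q.coeff ℓ₁ + 0) ^ 2 + 4 * (ℓ₁ + 1) * P.coeff (2 * ℓ₁ + 1))) := by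
      refine (Continuous.tendsto ?_ 0).mono_left nhdsWithin_le_nhds
      fun_prop
    have hneg : (Q.coeff ℓ₁ + 0) ^ 2 + 4 * (ℓ₁ + 1) * P.coeff (2 * ℓ₁ + 1) < 0 := by
      push_cast at hd
      linarith
    obtain ⟨δ, hδ, hδ0⟩ := ((hcont.eventually_lt_const hneg).and self_mem_nhdsWithin).exists
    refine ⟨δ, hδ0, ?_⟩
    have := ((hQlim.add_const δ).pow 2).add
      ((P.tendsto_eval_div_pow hP.le).const_mul (4 * ((ℓ₁ : ℝ) + 1)))
    filter_upwards [this.eventually_lt_const hδ] with x hx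
    exact hx.le

/-- Under the monodromy conditions no half-orbit escapes in a direction of the upper half plane,
or of the positive half-line. -/
theorem LienardOrbit.false_of_tendsto_direction {P Q : Polynomial ℝ} {X Y k : ℝ → ℝ}
    (h : LienardOrbit P Q X Y k) {ℓ₀ ℓ₁ : ℕ} (hP : P.natDegree = ℓ₀) (hQ : Q.natDegree = ℓ₁)
    (hmon : (Odd ℓ₀ ∧ ℓ₀ > 2 * ℓ₁ + 1 ∧ P.coeff ℓ₀ < 0) ∨
      (ℓ₀ = 2 * ℓ₁ + 1 ∧ Q.coeff ℓ₁ ^ 2 + 2 * ((ℓ₀ : ℝ) + 1) * P.coeff ℓ₀ < 0))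
    {ρ : ℝ → ℝ} (hρ : Tendsto ρ atTop atTop) {e₀ e₁ : ℝ}
    (he₀ : Tendsto (fun t ↦ X t / ρ t) atTop (𝓝 e₀))
    (he₁ : Tendsto (fun t ↦ Y t / ρ t) atTop (𝓝 e₁))
    (he : 0 < e₁ ∨ (e₁ = 0 ∧ 0 < e₀)) : False := by
  obtain ⟨δ, hδ, hR⟩ := exists_eventually_nonpos hP hQ hmon
  have hρ0 := hρ.eventually_gt_atTop 0
  rcases he with he | ⟨rfl, he⟩
  · have hY : Tendsto Y atTop atTop := by
      refine (hρ.atTop_mul_pos he he₁).congr' ?_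
      filter_upwards [hρ0] with t ht
      field_simp
    obtain ⟨T, hT⟩ := eventually_atTop.1 ((hY.eventually_ge_atTop 1).and (eventually_ge_atTop 0))
    have hT0 := (hT T le_rfl).2
    have hY1 : ∀ t, T ≤ t → 1 ≤ Y t := fun t ht ↦ (hT t ht).1
    refine h.false_of_tendsto_atTop hδ hR (tendsto_atTop.2 fun M ↦ ?_)
      (hY.eventually_gt_atTop 0)
    suffices ∃ t, T ≤ t ∧ M ≤ X t by
      obtain ⟨t, ht, hM⟩ := this
      filter_upwards [eventually_ge_atTop t] with s hs
      exact hM.trans (le_of_hasDerivAt_nonneg (fun s hs ↦ h.hasDerivAt_fst s (hT0.trans hs))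
        (fun s hs ↦ mul_nonneg (h.speed_pos s (hT0.trans hs)).le
          (zero_le_one.trans (hY1 s hs))) ht hs)
    by_contra! hcon
    obtain ⟨N, hN⟩ := h.exists_snd_le hT0 one_pos hY1 (fun t ht ↦ (hcon t ht).le)
    obtain ⟨t, ht, ht'⟩ := ((hY.eventually_gt_atTop N).and (eventually_ge_atTop T)).exists
    exact absurd (hN t ht') (not_le.2 ht)
  · have hX : Tendsto X atTop atTop := by
      refine (hρ.atTop_mul_pos he he₀).congr' ?_
      filter_upwards [hρ0] with t ht
      field_simp
    have hX0 := hX.eventually_gt_atTop 0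
    have hYX : Tendsto (fun t ↦ Y t / X t) atTop (𝓝 0) := by
      have := he₁.div he₀ he.ne'
      rw [zero_div] at this
      refine this.congr' ?_
      filter_upwards [hρ0] with t ht
      simp only [Pi.div_apply]
      field_simp
    obtain ⟨j, rfl⟩ : ∃ j, ℓ₀ = j + 1 := ⟨ℓ₀ - 1, by omega⟩
    have ha : P.coeff (j + 1) < 0 := by
      rcases hmon with ⟨-, -, ha⟩ | ⟨-, hd⟩
      · exact ha
      · by_contra! ha
        have : 0 ≤ Q.coeff ℓ₁ ^ 2 + 2 * (((j + 1 : ℕ) : ℝ) + 1) * P.coeff (j + 1) := by positivity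
        linarith
    have hQj : Q.natDegree ≤ j := by omega
    -- In the horizontal direction y/x → 0 and ℓ₁ ≤ ℓ₀ - 1, so P dominates and y' is eventually
    -- negative. Once y ≤ 0 it would stay so, and x could no longer increase: hence y > 0.
    have hlim : Tendsto (fun t ↦ P.eval (X t) / X t ^ (j + 1) +
        Q.eval (X t) / X t ^ j * (Y t / X t)) atTop (𝓝 (P.coeff (j + 1))) := by
      have := ((P.tendsto_eval_div_pow hP.le).comp hX).add
        (((Q.tendsto_eval_div_pow hQj).comp hX).mul hYX)
      simpa using this
    have hneg : ∀ᶠ t in atTop, P.eval (X t) + Q.eval (X t) * Y t < 0 := by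
      filter_upwards [hlim.eventually_lt_const ha, hX0] with t ht hx
      have := mul_neg_of_neg_of_pos ht (pow_pos hx (j + 1))
      refine lt_of_eq_of_lt ?_ this
      field_simp
      ring
    obtain ⟨T, hT⟩ := eventually_atTop.1 (hneg.and (eventually_ge_atTop 0))
    refine h.false_of_tendsto_atTop hδ hR hX ?_
    filter_upwards [eventually_ge_atTop T] with t ht
    by_contra! hYt
    have hYs : ∀ s, t ≤ s → Y s ≤ 0 := fun s hs ↦
      (le_of_hasDerivAt_nonpos (fun s hs ↦ h.hasDerivAt_snd s (hT s hs).2)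
        (fun s hs ↦ mul_nonpos_of_nonneg_of_nonpos (h.speed_pos s (hT s hs).2).le
          (hT s hs).1.le) ht hs).trans hYt
    obtain ⟨s, hs, hs'⟩ := ((hX.eventually_gt_atTop (X t)).and (eventually_ge_atTop t)).exists
    refine absurd (le_of_hasDerivAt_nonpos
      (fun s hs ↦ h.hasDerivAt_fst s (hT s (ht.trans hs)).2) (fun s hs ↦
        mul_nonpos_of_nonneg_of_nonpos (h.speed_pos s (hT s (ht.trans hs)).2).le (hYs s hs))
      le_rfl hs') (not_le.2 hs)

/-! ### Reflections and central projection -/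

/-- The right-hand side `s P(r x)` of a rescaled equation. -/
noncomputable def Polynomial.rescale (s r : ℝ) (P : Polynomial ℝ) : Polynomial ℝ :=
  Polynomial.C s * P.comp (Polynomial.C r * Polynomial.X)

theorem Polynomial.eval_rescale (s r : ℝ) (P : Polynomial ℝ) (x : ℝ) :
    (P.rescale s r).eval x = s * P.eval (r * x) := by
  simp [Polynomial.rescale]

theorem Polynomial.coeff_rescale (s r : ℝ) (P : Polynomial ℝ) (n : ℕ) :
    (P.rescale s r).coeff n = s * (P.coeff n * r ^ n) := by
  simp [Polynomial.rescale]

theorem Polynomial.natDegree_rescale {s r : ℝ} (hs : s ≠ 0) (hr : r ≠ 0) (P : Polynomial ℝ) :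
    (P.rescale s r).natDegree = P.natDegree := by
  rw [Polynomial.rescale, Polynomial.natDegree_C_mul hs, Polynomial.natDegree_comp,
    Polynomial.natDegree_C_mul_X _ hr, mul_one]

section

variable {P₀ P₁ : Polynomial ℝ} {σ τ : ℝ} {β : ℝ → Fin 3 → ℝ}

theorem one_le_degree_lienardSystem (P₀ P₁ : Polynomial ℝ) :
    1 ≤ (lienardSystem P₀ P₁).degree :=
  le_max_of_le_left (MvPolynomial.totalDegree_X (1 : Fin 2)).ge

theorem eval_lienardSystem_P (P₀ P₁ : Polynomial ℝ) (x y : ℝ) :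
    MvPolynomial.eval ![x, y] (lienardSystem P₀ P₁).P = y := by
  simp [lienardSystem]

theorem eval_lienardSystem_Q (P₀ P₁ : Polynomial ℝ) (x y : ℝ) :
    MvPolynomial.eval ![x, y] (lienardSystem P₀ P₁).Q = P₀.eval x + P₁.eval x * y := by
  have h : ∀ p : Polynomial ℝ, MvPolynomial.eval ![x, y]
      (Polynomial.aeval (MvPolynomial.X 0 : MvPolynomial (Fin 2) ℝ) p) = p.eval x := by
    intro p
    have := Polynomial.hom_eval₂ p (algebraMap ℝ (MvPolynomial (Fin 2) ℝ))
      (MvPolynomial.eval ![x, y]) (MvPolynomial.X 0)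
    rw [Polynomial.aeval_def, this]
    have hid : (MvPolynomial.eval ![x, y]).comp (algebraMap ℝ (MvPolynomial (Fin 2) ℝ)) =
        RingHom.id ℝ := by
      ext
      simp
    rw [hid, MvPolynomial.eval_X]
    rfl
  simp [lienardSystem, h]

theorem sqrt_one_add_eq_inv {z : Fin 3 → ℝ} (hz : z ∈ northernHemisphere) :
    √(1 + (z 0 / z 2) ^ 2 + (z 1 / z 2) ^ 2) = (z 2)⁻¹ := by
  have h2 := hz.2
  have : 1 + (z 0 / z 2) ^ 2 + (z 1 / z 2) ^ 2 = ((z 2)⁻¹) ^ 2 := by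
    field_simp
    linarith [hz.1]
  rw [this, Real.sqrt_sq (inv_pos.2 h2).le]

/-- The central projection of an orbit of the Poincaré compactification, up to a reversal of time
and reflections in the axes. -/
theorem lienardOrbit_of_hasDerivAt (hσ : σ ^ 2 = 1) (hτ : τ ^ 2 = 1)
    (hβ : ∀ t, 0 ≤ t → HasDerivAt β (τ • (lienardSystem P₀ P₁).poincareField (β t)) t)
    (hβN : ∀ t, 0 ≤ t → β t ∈ northernHemisphere) :
    LienardOrbit (P₀.rescale (σ * τ) (σ * τ)) (P₁.rescale τ (σ * τ))
      (fun t ↦ σ * τ * (β t 0 / β t 2)) (fun t ↦ σ * (β t 1 / β t 2))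
      (fun t ↦ β t 2 ^ ((lienardSystem P₀ P₁).degree - 1)) := by
  set S := lienardSystem P₀ P₁ with hS
  obtain ⟨d, hd⟩ : ∃ d, S.degree = d + 1 :=
    ⟨S.degree - 1, (Nat.sub_add_cancel (one_le_degree_lienardSystem P₀ P₁)).symm⟩
  have hστ : (σ * τ) * (σ * τ) = 1 := by
    linear_combination τ ^ 2 * hσ + hτ
  have hdi : ∀ t, 0 ≤ t → ∀ i, HasDerivAt (fun t ↦ β t i) (τ * S.poincareField (β t) i) t :=
    fun t ht i ↦ hasDerivAt_pi.1 (hβ t ht) i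
  have hp : ∀ t, 0 ≤ t → homogenization (d + 1) S.P (β t) =
      β t 2 ^ (d + 1) * (β t 1 / β t 2) := by
    intro t ht
    rw [← hd, homogenization_eq (show S.P.totalDegree ≤ S.degree from le_max_left _ _)
      (hβN t ht).2.ne', eval_lienardSystem_P]
  have hq : ∀ t, 0 ≤ t → homogenization (d + 1) S.Q (β t) = β t 2 ^ (d + 1) *
      (P₀.eval (β t 0 / β t 2) + P₁.eval (β t 0 / β t 2) * (β t 1 / β t 2)) := by
    intro t ht
    rw [← hd, homogenization_eq (show S.Q.totalDegree ≤ S.degree from le_max_right _ _)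
      (hβN t ht).2.ne', eval_lienardSystem_Q]
  refine ⟨fun t ht ↦ ?_, fun t ht ↦ ?_, fun t ht ↦ pow_pos (hβN t ht).2 _⟩
  · have h2 := (hβN t ht).2
    have := ((hdi t ht 0).div (hdi t ht 2) h2.ne').const_mul (σ * τ)
    convert! this using 1
    simp only [PlanarSystem.poincareField, hd, hp t ht, Nat.add_sub_cancel, Matrix.cons_val_zero,
      Matrix.cons_val]
    -- The radial correction cancels in the quotient `z 0 / z 2`, whose derivative is `p / z 2` up
    -- to sign, so the value of q is irrelevant.
    generalize homogenization (d + 1) S.Q (β t) = q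
    field_simp
    linear_combination (-(σ * β t 1 * β t 2 ^ (d + 1))) * hτ
  · have h2 := (hβN t ht).2
    have := ((hdi t ht 1).div (hdi t ht 2) h2.ne').const_mul σ
    convert! this using 1
    simp only [PlanarSystem.poincareField, hd, hq t ht, Nat.add_sub_cancel, Matrix.cons_val_one,
      Matrix.cons_val, Polynomial.eval_rescale]
    rw [← mul_assoc (σ * τ) (σ * τ), hστ, one_mul]
    generalize P₀.eval (β t 0 / β t 2) = A
    generalize P₁.eval (β t 0 / β t 2) = B
    generalize homogenization (d + 1) S.P (β t) = p
    field_simp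
    ring

/-- On the hemisphere 1 / `z 2` = √(1 + x² + y²), so bounds on x and y keep `z 2`, and with it the
speed, away from 0. -/
theorem completeLienardOrbit_of_hasDerivAt (hσ : σ ^ 2 = 1) (hτ : τ ^ 2 = 1)
    (hβ : ∀ t, HasDerivAt β (τ • (lienardSystem P₀ P₁).poincareField (β t)) t)
    (hβN : ∀ t, β t ∈ northernHemisphere) :
    CompleteLienardOrbit (P₀.rescale (σ * τ) (σ * τ)) (P₁.rescale τ (σ * τ))
      (fun t ↦ σ * τ * (β t 0 / β t 2)) (fun t ↦ σ * (β t 1 / β t 2))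
      (fun t ↦ β t 2 ^ ((lienardSystem P₀ P₁).degree - 1)) := by
  refine ⟨lienardOrbit_of_hasDerivAt hσ hτ (fun t _ ↦ hβ t) fun t _ ↦ hβN t, ?_, fun R ↦ ?_⟩
  · have : Continuous β := continuous_iff_continuousAt.2 fun t ↦ (hβ t).continuousAt
    fun_prop
  · refine ⟨(√(1 + R ^ 2 + R ^ 2))⁻¹ ^ ((lienardSystem P₀ P₁).degree - 1),
      pow_pos (inv_pos.2 (Real.sqrt_pos.2 (by positivity))) _, fun t _ hX hY ↦ ?_⟩
    refine pow_le_pow_left₀ (inv_nonneg.2 (Real.sqrt_nonneg _)) ?_ _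
    refine inv_le_of_inv_le₀ (hβN t).2 ?_
    rw [← sqrt_one_add_eq_inv (hβN t)]
    refine Real.sqrt_le_sqrt ?_
    have hX' := sq_le_sq' (abs_le.1 hX).1 (abs_le.1 hX).2
    have hY' := sq_le_sq' (abs_le.1 hY).1 (abs_le.1 hY).2
    rw [mul_pow, mul_pow, hσ, hτ, one_mul, one_mul] at hX'
    rw [mul_pow, hσ, one_mul] at hY'
    linarith

/-- The compactified flow supplies a complete orbit through the prescribed point. Its direction
coordinates are, up to sign, `z 0` and `z 1`, while `z 2` → 0 because 1 / `z 2` ≥ x; so it converges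
on the equator, necessarily to a zero of the field. The sign τ decides between forward and backward
time. -/
theorem not_monodromicAtInfinity_of_hasEscapingOrbit (hσ : σ ^ 2 = 1) (hτ : τ = 1 ∨ τ = -1)
    (h : HasEscapingOrbit (P₀.rescale (σ * τ) (σ * τ)) (P₁.rescale τ (σ * τ))) :
    ¬(lienardSystem P₀ P₁).MonodromicAtInfinity := by
  have hτ2 : τ ^ 2 = 1 := by rcases hτ with rfl | rfl <;> norm_num
  have hστ : (σ * τ) ^ 2 = 1 := by rw [mul_pow, hσ, hτ2, one_mul]
  obtain ⟨x₀, y₀, e₀, e₁, h⟩ := h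
  set ρ := √(1 + x₀ ^ 2 + y₀ ^ 2) with hρ
  have hρpos : 0 < ρ := Real.sqrt_pos.2 (by positivity)
  have hρ2 : ρ ^ 2 = 1 + x₀ ^ 2 + y₀ ^ 2 := Real.sq_sqrt (by positivity)
  obtain ⟨γ, h0, hγ, hγN⟩ := (lienardSystem P₀ P₁).exists_integralCurve
    (z₀ := ![σ * τ * x₀ / ρ, σ * y₀ / ρ, 1 / ρ]) (by
      refine ⟨?_, by simpa using hρpos⟩
      simp only [Matrix.cons_val_zero, Matrix.cons_val_one, Matrix.cons_val]
      field_simp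
      rw [hρ2]
      linear_combination x₀ ^ 2 * hστ + y₀ ^ 2 * hσ)
  set β : ℝ → Fin 3 → ℝ := fun t ↦ γ (τ * t) with hβdef
  have hβ : ∀ t, HasDerivAt β (τ • (lienardSystem P₀ P₁).poincareField (β t)) t := by
    intro t
    have hl : HasDerivAt (fun t : ℝ ↦ τ * t) τ t := by
      simpa using (hasDerivAt_id t).const_mul τ
    exact (hγ (τ * t)).scomp t hl
  have hβN : ∀ t, β t ∈ northernHemisphere := fun t ↦ hγN _
  obtain ⟨hX, hd₀, hd₁⟩ := h _ _ _ (completeLienardOrbit_of_hasDerivAt hσ hτ2 hβ hβN)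
    (by
      simp only [hβdef, mul_zero, h0, Matrix.cons_val_zero, Matrix.cons_val]
      field_simp
      linear_combination x₀ * hστ)
    (by
      simp only [hβdef, mul_zero, h0, Matrix.cons_val_one, Matrix.cons_val]
      field_simp
      linear_combination y₀ * hσ)
  have hsqrt : ∀ t, √(1 + (σ * τ * (β t 0 / β t 2)) ^ 2 + (σ * (β t 1 / β t 2)) ^ 2) =
      (β t 2)⁻¹ := by
    intro t
    rw [mul_pow (σ * τ), hστ, one_mul, mul_pow σ, hσ, one_mul, sqrt_one_add_eq_inv (hβN t)]
  simp only [hsqrt] at hd₀ hd₁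
  have hc₀ : Tendsto (fun t ↦ β t 0) atTop (𝓝 (σ * τ * e₀)) := by
    refine (hd₀.const_mul (σ * τ)).congr fun t ↦ ?_
    have := (hβN t).2.ne'
    field_simp
    linear_combination β t 0 * hστ
  have hc₁ : Tendsto (fun t ↦ β t 1) atTop (𝓝 (σ * e₁)) := by
    refine (hd₁.const_mul σ).congr fun t ↦ ?_
    have := (hβN t).2.ne'
    field_simp
    linear_combination β t 1 * hσ
  have hc₂ : Tendsto (fun t ↦ β t 2) atTop (𝓝 0) := by
    have : Tendsto (fun t ↦ (β t 2)⁻¹) atTop atTop := by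
      refine tendsto_atTop_mono (fun t ↦ ?_) hX
      rw [← hsqrt t]
      refine Real.le_sqrt_of_sq_le ?_
      linarith [sq_nonneg (σ * (β t 1 / β t 2))]
    exact this.inv_tendsto_atTop.congr fun t ↦ inv_inv _
  set e : Fin 3 → ℝ := ![σ * τ * e₀, σ * e₁, 0] with he
  have hlim : Tendsto β atTop (𝓝 e) := by
    refine tendsto_pi_nhds.2 fun i ↦ ?_
    fin_cases i
    · exact hc₀
    · exact hc₁
    · exact hc₂
  have hequator : e ∈ equator := by
    refine ⟨?_, rfl⟩
    have h1 := ((hc₀.pow 2).add (hc₁.pow 2)).add (hc₂.pow 2)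
    exact tendsto_nhds_unique h1 (tendsto_const_nhds.congr fun t ↦ (hβN t).1.symm)
  have hzero : (lienardSystem P₀ P₁).poincareField e = 0 := by
    have hcont : Continuous fun z ↦ τ • (lienardSystem P₀ P₁).poincareField z :=
      (lienardSystem P₀ P₁).contDiff_poincareField.continuous.const_smul τ
    have := eq_zero_of_tendsto_of_hasDerivAt hcont hβ hlim
    have hτ0 : τ ≠ 0 := by rintro rfl; norm_num at hτ2
    exact (smul_eq_zero_iff_right hτ0).1 this
  intro hmon
  refine hmon e ⟨hequator, hzero⟩ ⟨γ, ?_⟩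
  rcases hτ with rfl | rfl
  · left
    refine ⟨fun t _ ↦ (hγ t).hasDerivWithinAt, fun t _ ↦ hγN t, ?_⟩
    simpa [hβdef] using hlim
  · right
    refine ⟨fun t _ ↦ (hγ t).hasDerivWithinAt, fun t _ ↦ hγN t, ?_⟩
    refine (hlim.comp tendsto_neg_atBot_atTop).congr fun t ↦ ?_
    simp [hβdef]

/-- Both conditions need ℓ₀ odd, and then s · s^ℓ₀ = 1; the leading coefficient of P₁ enters only
through its square. -/
theorem rescale_condition_iff {s : ℝ} {ℓ₀ ℓ₁ : ℕ} (hs : s ^ 2 = 1) (hτ : τ ^ 2 = 1) :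
    ((Odd ℓ₀ ∧ ℓ₀ > 2 * ℓ₁ + 1 ∧ (P₀.rescale s s).coeff ℓ₀ < 0) ∨
      (ℓ₀ = 2 * ℓ₁ + 1 ∧ (P₁.rescale τ s).coeff ℓ₁ ^ 2 +
        2 * ((ℓ₀ : ℝ) + 1) * (P₀.rescale s s).coeff ℓ₀ < 0)) ↔
    ((Odd ℓ₀ ∧ ℓ₀ > 2 * ℓ₁ + 1 ∧ P₀.coeff ℓ₀ < 0) ∨
      (ℓ₀ = 2 * ℓ₁ + 1 ∧ P₁.coeff ℓ₁ ^ 2 + 2 * ((ℓ₀ : ℝ) + 1) * P₀.coeff ℓ₀ < 0)) := by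
  by_cases hodd : Odd ℓ₀
  · have h0 : (P₀.rescale s s).coeff ℓ₀ = P₀.coeff ℓ₀ := by
      obtain ⟨j, rfl⟩ := hodd
      rw [Polynomial.coeff_rescale, pow_succ, pow_mul, hs, one_pow]
      linear_combination P₀.coeff (2 * j + 1) * hs
    have h1 : (P₁.rescale τ s).coeff ℓ₁ ^ 2 = P₁.coeff ℓ₁ ^ 2 := by
      rw [Polynomial.coeff_rescale, mul_pow, mul_pow, hτ, ← pow_mul, mul_comm ℓ₁ 2, pow_mul, hs,
        one_pow, one_mul, mul_one]
    rw [h0, h1]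
  · have hne : ℓ₀ ≠ 2 * ℓ₁ + 1 := fun h ↦ hodd ⟨ℓ₁, h⟩
    simp [hodd, hne]

/-- The sign σ reflects the limit point into the open upper half plane, or onto the positive x-axis
if it lies on that axis; 1 / `z 2` then serves as the diverging radius. -/
theorem false_of_connecting {ℓ₀ ℓ₁ : ℕ} (hℓ₀ : P₀.natDegree = ℓ₀) (hℓ₁ : P₁.natDegree = ℓ₁)
    (hτ : τ ^ 2 = 1)
    (h : (Odd ℓ₀ ∧ ℓ₀ > 2 * ℓ₁ + 1 ∧ P₀.coeff ℓ₀ < 0) ∨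
      (ℓ₀ = 2 * ℓ₁ + 1 ∧ P₁.coeff ℓ₁ ^ 2 + 2 * ((ℓ₀ : ℝ) + 1) * P₀.coeff ℓ₀ < 0))
    (hβ : ∀ t, 0 ≤ t → HasDerivAt β (τ • (lienardSystem P₀ P₁).poincareField (β t)) t)
    (hβN : ∀ t, 0 ≤ t → β t ∈ northernHemisphere) {e : Fin 3 → ℝ} (he : e ∈ equator)
    (hlim : Tendsto β atTop (𝓝 e)) : False := by
  have hlim' := tendsto_pi_nhds.1 hlim
  have hτ0 : τ ≠ 0 := by rintro rfl; norm_num at hτ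
  obtain ⟨σ, hσ, hsign⟩ : ∃ σ : ℝ, σ ^ 2 = 1 ∧
      (0 < σ * e 1 ∨ (σ * e 1 = 0 ∧ 0 < σ * τ * e 0)) := by
    have key : ∀ r : ℝ, r ≠ 0 → ∃ s : ℝ, s ^ 2 = 1 ∧ 0 < s * r := by
      intro r hr
      rcases hr.lt_or_gt with h | h
      · exact ⟨-1, by norm_num, by linarith⟩
      · exact ⟨1, by norm_num, by linarith⟩
    by_cases h1 : e 1 = 0
    · have h0 : e 0 ≠ 0 := by
        intro h0
        have := he.1
        rw [h0, h1, he.2] at this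
        norm_num at this
      obtain ⟨σ, hσ, hpos⟩ := key (τ * e 0) (mul_ne_zero hτ0 h0)
      exact ⟨σ, hσ, Or.inr ⟨by rw [h1, mul_zero], by rwa [mul_assoc]⟩⟩
    · obtain ⟨σ, hσ, hpos⟩ := key _ h1
      exact ⟨σ, hσ, Or.inl hpos⟩
  have hσ0 : σ ≠ 0 := by rintro rfl; norm_num at hσ
  have hρ : Tendsto (fun t ↦ (β t 2)⁻¹) atTop atTop := by
    have h2 := hlim' 2
    rw [he.2] at h2
    refine (tendsto_nhdsWithin_iff.2 ⟨h2, ?_⟩).inv_tendsto_nhdsGT_zero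
    filter_upwards [eventually_ge_atTop 0] with t ht
    exact (hβN t ht).2
  refine (lienardOrbit_of_hasDerivAt hσ hτ hβ hβN).false_of_tendsto_direction
    ((Polynomial.natDegree_rescale (mul_ne_zero hσ0 hτ0) (mul_ne_zero hσ0 hτ0) P₀).trans hℓ₀)
    ((Polynomial.natDegree_rescale hτ0 (mul_ne_zero hσ0 hτ0) P₁).trans hℓ₁)
    ((rescale_condition_iff (by rw [mul_pow, hσ, hτ, one_mul]) hτ).2 h) hρ (e₀ := σ * τ * e 0) (e₁ := σ * e 1) ?_ ?_ hsign
  · refine ((hlim' 0).const_mul (σ * τ)).congr' ?_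
    filter_upwards [eventually_ge_atTop 0] with t ht
    have := (hβN t ht).2.ne'
    field_simp
  · refine ((hlim' 1).const_mul σ).congr' ?_
    filter_upwards [eventually_ge_atTop 0] with t ht
    have := (hβN t ht).2.ne'
    field_simp

theorem monodromicAtInfinity_of_condition {ℓ₀ ℓ₁ : ℕ} (hℓ₀ : P₀.natDegree = ℓ₀)
    (hℓ₁ : P₁.natDegree = ℓ₁)
    (h : (Odd ℓ₀ ∧ ℓ₀ > 2 * ℓ₁ + 1 ∧ P₀.coeff ℓ₀ < 0) ∨
      (ℓ₀ = 2 * ℓ₁ + 1 ∧ P₁.coeff ℓ₁ ^ 2 + 2 * ((ℓ₀ : ℝ) + 1) * P₀.coeff ℓ₀ < 0)) :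
    (lienardSystem P₀ P₁).MonodromicAtInfinity := by
  rintro e ⟨he, -⟩ ⟨γ, ⟨hγ, hN, hlim⟩ | ⟨hγ, hN, hlim⟩⟩
  -- The shift by 1 turns the one-sided derivative at the end of the half-line into a two-sided one.
  · refine false_of_connecting (τ := 1) (β := fun t ↦ γ (t + 1)) hℓ₀ hℓ₁ (by norm_num) h
      (fun t ht ↦ ?_) (fun t ht ↦ hN _ (by simp only [Set.mem_Ici]; linarith)) he
      (hlim.comp (tendsto_atTop_add_const_right _ 1 tendsto_id))
    have hmem : t + 1 ∈ Set.Ici (0 : ℝ) := by simp only [Set.mem_Ici]; linarith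
    have := (hγ _ hmem).hasDerivAt (Ici_mem_nhds (by linarith))
    exact this.scomp t ((hasDerivAt_id t).add_const 1)
  · refine false_of_connecting (τ := -1) (β := fun t ↦ γ (-(t + 1))) hℓ₀ hℓ₁ (by norm_num) h
      (fun t ht ↦ ?_) (fun t ht ↦ hN _ (by simp only [Set.mem_Iic]; linarith)) he
      (hlim.comp (tendsto_neg_atTop_atBot.comp (tendsto_atTop_add_const_right _ 1 tendsto_id)))
    have hmem : -(t + 1) ∈ Set.Iic (0 : ℝ) := by simp only [Set.mem_Iic]; linarith
    have := (hγ _ hmem).hasDerivAt (Iic_mem_nhds (by linarith))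
    exact this.scomp t ((hasDerivAt_id t).add_const 1).neg

theorem exists_sign_mul_pos {r : ℝ} (hr : r ≠ 0) : ∃ s : ℝ, (s = 1 ∨ s = -1) ∧ 0 < s * r := by
  rcases hr.lt_or_gt with h | h
  · exact ⟨-1, Or.inr rfl, by linarith⟩
  · exact ⟨1, Or.inl rfl, by linarith⟩

end

/-! ### The characterization -/

theorem lemma5p1 (P₀ P₁ : Polynomial ℝ) (ℓ₀ ℓ₁ : ℕ)
    (hℓ₀ : P₀.natDegree = ℓ₀) (hℓ₁ : P₁.natDegree = ℓ₁)
    (hab : P₀.coeff ℓ₀ * P₁.coeff ℓ₁ ≠ 0) :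
    (lienardSystem P₀ P₁).MonodromicAtInfinity ↔
      (Odd ℓ₀ ∧ ℓ₀ > 2 * ℓ₁ + 1 ∧ P₀.coeff ℓ₀ < 0) ∨
        (ℓ₀ = 2 * ℓ₁ + 1 ∧
          P₁.coeff ℓ₁ ^ 2 + 2 * ((ℓ₀ : ℝ) + 1) * P₀.coeff ℓ₀ < 0) := by
  refine ⟨fun hmon ↦ ?_, monodromicAtInfinity_of_condition hℓ₀ hℓ₁⟩
  by_contra hcon
  obtain ⟨ha, hb⟩ := mul_ne_zero_iff.1 hab
  have sq_of : ∀ {s : ℝ}, s = 1 ∨ s = -1 → s ^ 2 = 1 := by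
    rintro s (rfl | rfl) <;> norm_num
  -- the escaping orbit is found for the system reflected by the signs `s` (of `x`) and `τ` (of `t`)
  suffices ∃ s τ : ℝ, (s = 1 ∨ s = -1) ∧ (τ = 1 ∨ τ = -1) ∧
      HasEscapingOrbit (P₀.rescale s s) (P₁.rescale τ s) by
    obtain ⟨s, τ, hs, hτ, h⟩ := this
    have hsτ : s * τ * τ = s := by rw [mul_assoc, ← sq, sq_of hτ, mul_one]
    refine not_monodromicAtInfinity_of_hasEscapingOrbit (σ := s * τ) (τ := τ) ?_ hτ ?_ hmon
    · rw [mul_pow, sq_of hs, sq_of hτ, one_mul]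
    · rwa [hsτ]
  by_cases hconst : ℓ₀ = 0 ∧ ℓ₁ = 0
  · obtain ⟨rfl, rfl⟩ := hconst
    obtain ⟨a, rfl⟩ := Polynomial.natDegree_eq_zero.1 hℓ₀
    obtain ⟨b, rfl⟩ := Polynomial.natDegree_eq_zero.1 hℓ₁
    rw [Polynomial.coeff_C_zero] at ha hb
    obtain ⟨s, hs, hsa⟩ := exists_sign_mul_pos ha
    -- Here τ b must be negative, unlike in the other cases, to put the invariant line y = -s a/(τ
    -- b) above the axis.
    obtain ⟨τ, hτ, hτb⟩ := exists_sign_mul_pos (neg_ne_zero.2 hb)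
    refine ⟨s, τ, hs, hτ, ?_⟩
    have := hasEscapingOrbit_of_const hsa (by linarith : τ * b < 0)
    simpa [Polynomial.rescale] using this
  -- For even ℓ₀ the sign s makes the leading coefficient of P₀ positive; for odd ℓ₀ no reflection
  -- changes it. Then τ makes that of P₁ positive.
  · have hsgn : ∃ s : ℝ, (s = 1 ∨ s = -1) ∧
        (0 < (P₀.rescale s s).coeff ℓ₀ ∨ Odd ℓ₀) := by
      rcases Nat.even_or_odd ℓ₀ with hev | hodd
      · obtain ⟨s, hs, hsa⟩ := exists_sign_mul_pos ha
        refine ⟨s, hs, Or.inl ?_⟩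
        obtain ⟨j, rfl⟩ := hev.exists_two_nsmul
        rw [Polynomial.coeff_rescale, smul_eq_mul, pow_mul, sq_of hs, one_pow, mul_one]
        exact hsa
      · exact ⟨1, Or.inl rfl, Or.inr hodd⟩
    obtain ⟨s, hs, hsign⟩ := hsgn
    have hs0 : s ≠ 0 := by rcases hs with rfl | rfl <;> norm_num
    obtain ⟨τ, hτ, hτb⟩ := exists_sign_mul_pos (mul_ne_zero hb (pow_ne_zero ℓ₁ hs0))
    have hτ0 : τ ≠ 0 := by rcases hτ with rfl | rfl <;> norm_num
    refine ⟨s, τ, hs, hτ, ?_⟩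
    have hcon' := mt (rescale_condition_iff (P₀ := P₀) (P₁ := P₁) (ℓ₀ := ℓ₀) (ℓ₁ := ℓ₁)
      (sq_of hs) (sq_of hτ)).1 hcon
    refine hasEscapingOrbit_of_not ((Polynomial.natDegree_rescale hs0 hs0 P₀).trans hℓ₀)
      ((Polynomial.natDegree_rescale hτ0 hs0 P₁).trans hℓ₁) ?_ ?_ hsign (by omega)
      (fun h ↦ hcon' (Or.inl h)) fun h ↦ hcon' (Or.inr h)
    · rw [Polynomial.coeff_rescale]
      exact mul_ne_zero hs0 (mul_ne_zero ha (pow_ne_zero _ hs0))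
    · rwa [Polynomial.coeff_rescale]
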